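/- Let $\ell:\mathbb R^d\to(-\infty,\infty]$ be a multivariate loss function: componentwise increasing, convex, lower semicontinuous, $\inf\ell<0$, and $\ell(x)\ge\sum_k x_k-c$ for some $c\in\mathbb R$. Let $X$ be a random vector in $\mathbb R^d$ that has a density and satisfies $\mathbb E[\ell(t|X|)]<\infty$ for all $t>0$ ($|X|$ componentwise; $\ell$ is then finite everywhere). Put $g(m)=\mathbb E[\ell(X-m)]$. All gradients $\nabla$ and Hessians $\nabla^2$ below are taken with respect to the allocation $m$. For $z=(m,\lambda)\in\mathbb R^{d}\times\mathbb R$ put $$\mathcal L(x,z)=\sum_k m_k+\lambda\,\ell(x-m),\qquad \mathcal L(z)=\sum_k m_k+\lambda\, g(m),$$ $$\nabla_z\mathcal L(x,z)=\begin{pmatrix}\mathbf 1+\lambda\nabla[\ell(x-m)]\\ \ell(x-m)\end{pmatrix},\qquad \nabla_z^2\mathcal L(z)=\begin{pmatrix}\lambda\nabla^2g(m)&\nabla g(m)\\ \nabla g(m)^\top&0\end{pmatrix}.$$ Let $M\subset\mathbb R^d$ be compact and $\bar\lambda>0$, and let $z^*=(m^*,\lambda^*)$, with $m^*$ in the interior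 of $M$ and $0<\lambda^*<\bar\lambda$, be such that $m^*$ is a local solution of $\min\{\sum_k m_k: g(m)\le0\}$ with multiplier $\lambda^*$, i.e. $\mathbf 1+\lambda^*\nabla g(m^*)=0$ and $g(m^*)=0$. Assume: 1. for every $m_0\in\mathbb R^d$, almost surely, $m\mapsto\nabla[\ell(X-m)]$ is differentiable at $m_0$ and $m\mapsto\nabla^2[\ell(X-m)]$ is continuous at $m_0$ (each map being defined in a neighbourhood of $m_0$); 2. (strong second-order sufficient condition) $a^\top\nabla^2g(m^*)a>0$ for every $a\ne0$ with $\nabla g(m^*)^\top a=0$; 3. there are integrable random variables $D_0,D_1,D_2$ such that for every $m\in M$, almost surely, $|\ell(X-m)|\le D_0$, $\|\nabla[\ell(X-m)]\|\le D_1$, $\|\nabla^2[\ell(X-m)]\|\le D_2$; and, almost surely, $m\mapsto\nabla[\ell(X-m)]$ exists and is locally Lipschitz in the interior of $M$; 4. $\mathbb E\|\nabla_z\mathcal L(X,z^*)\|^2<\infty$. Let $X^{(1)},X^{(2)},\dots$ be i.i.d. copies of $X$. A solution of the SAA problem in $\mathcal Z=M\times(0,\bar\lambda]$ is a $z=(m,\lambda)\in\mathcal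 Z$ such that $m$ minimizes $\sum_k m_k$ over the $m\in M$ with $\frac1N\sum_{i=1}^N\ell(X^{(i)}-m)\le0$ and the first-order condition $\frac1N\sum_{i=1}^N\nabla_z\mathcal L(X^{(i)},z)=0$ holds. Let $z_N^{\mathrm{SAA}}$ be random vectors such that, for each $N$, almost surely, $z_N^{\mathrm{SAA}}$ is a solution of the SAA problem in $\mathcal Z$ whenever one exists. Then $\nabla_z^2\mathcal L(z^*)$ is invertible, the matrix $$V(z^*)=\bigl(\nabla_z^2\mathcal L(z^*)\bigr)^{-1}H(z^*)\bigl(\nabla_z^2\mathcal L(z^*)\bigr)^{-1},\qquad H(z^*)=\operatorname{Var}\bigl(\nabla_z\mathcal L(X,z^*)\bigr),$$ is positive semidefinite, and as $N\to\infty$ $$\sqrt N\,\bigl(z_N^{\mathrm{SAA}}-z^*\bigr)\longrightarrow\mathcal N\bigl(0,V(z^*)\bigr)\quad\text{in law.}$$ -/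

import Mathlib

open MeasureTheory ProbabilityTheory Filter Topology

namespace MSRM

/-- The space `ℝ^d` of losses and capital allocations, with the Euclidean norm. -/
abbrev Alloc (d : ℕ) : Type := EuclideanSpace ℝ (Fin d)

/-- The space `ℝ^(d+1)` of primal-dual variables `z = (m, lam)`. -/
abbrev PrimalDual (d : ℕ) : Type := EuclideanSpace ℝ (Fin d ⊕ Unit)

/-- The primal part `m` of `z = (m, lam)`. -/
noncomputable def primal {d : ℕ} (z : PrimalDual d) : Alloc d :=
  WithLp.toLp 2 (fun k => z (Sum.inl k))

/-- The dual part `lam` (the Lagrange multiplier) of `z = (m, lam)`. -/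
noncomputable def multiplier {d : ℕ} (z : PrimalDual d) : ℝ := z (Sum.inr ())

/-- The vector of `ℝ^(d+1)` with blocks `v` and `t`. -/
noncomputable def mkPD {d : ℕ} (v : Alloc d) (t : ℝ) : PrimalDual d :=
  WithLp.toLp 2 (Sum.elim (fun k => v k) (fun _ => t))

/-- A multivariate loss function `ℝ^d → (-∞, ∞]`: increasing, convex and lower semicontinuous,
with negative infimum, and above a translate of the sum of the coordinates. -/
structure IsLossFunction {d : ℕ} (loss : Alloc d → EReal) : Prop where
  ne_bot : ∀ x, loss x ≠ ⊥
  mono : ∀ x y : Alloc d, (∀ k, y k ≤ x k) → loss y ≤ loss x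
  convex : ∀ (x y : Alloc d) (a b : ℝ), 0 ≤ a → 0 ≤ b → a + b = 1 →
    loss (a • x + b • y) ≤ (a : EReal) * loss x + (b : EReal) * loss y
  lsc : LowerSemicontinuous loss
  iInf_neg : (⨅ x, loss x) < 0
  lower : ∃ c : ℝ, ∀ x : Alloc d, (((∑ k, x k) - c : ℝ) : EReal) ≤ loss x

/-- The vector of absolute values of the coordinates. -/
noncomputable def absVec {d : ℕ} (x : Alloc d) : Alloc d := WithLp.toLp 2 (fun k => |x k|)

/-- `X` belongs to the Orlicz heart of `x ↦ loss |x|`, that is, `E[loss |t X|] < ∞` for all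
`t > 0`. Only the positive part of the integrand matters: a loss function is bounded below on
vectors with nonnegative coordinates. -/
def InOrliczHeart {d : ℕ} {Ω : Type*} [MeasurableSpace Ω] (μ : Measure Ω)
    (loss : Alloc d → EReal) (X : Ω → Alloc d) : Prop :=
  AEMeasurable X μ ∧ ∀ t : ℝ, 0 < t → ∫⁻ ω, (loss (absVec (t • X ω))).toENNReal ∂μ < ⊤

/-- The loss `m ↦ loss (x - m)` left at the realization `x` by the allocation `m`, as a real
number. If `X` has a density and lies in the Orlicz heart, then `loss` is finite everywhere, and
`loss (X - m)` is integrable for each `m`. -/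
noncomputable def residual {d : ℕ} (loss : Alloc d → EReal) (x : Alloc d) : Alloc d → ℝ :=
  fun m => (loss (x - m)).toReal

/-- The constraint function `g(m) = E[loss (X - m)]`. -/
noncomputable def expectedLoss {d : ℕ} {Ω : Type*} [MeasurableSpace Ω] (μ : Measure Ω)
    (loss : Alloc d → EReal) (X : Ω → Alloc d) : Alloc d → ℝ :=
  fun m => ∫ ω, residual loss (X ω) m ∂μ

/-- The sample average approximation `g_N(m) = (1/N) ∑_{i < N} loss (X_i - m)`. -/
noncomputable def sampleLoss {d : ℕ} (loss : Alloc d → EReal) (x : ℕ → Alloc d) (N : ℕ) :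
    Alloc d → ℝ :=
  fun m => (N : ℝ)⁻¹ * ∑ i ∈ Finset.range N, residual loss (x i) m

/-- The Hessian of `f` at `m`, as the derivative of the gradient. -/
noncomputable def hess {d : ℕ} (f : Alloc d → ℝ) (m : Alloc d) : Alloc d →L[ℝ] Alloc d :=
  fderiv ℝ (gradient f) m

/-- The Hessian matrix of `f` at `m`. -/
noncomputable def hessMatrix {d : ℕ} (f : Alloc d → ℝ) (m : Alloc d) :
    Matrix (Fin d) (Fin d) ℝ :=
  Matrix.of fun i j => hess f m (EuclideanSpace.single j 1) i

/-- The gradient in `z = (m, lam)` of the Lagrangian `∑ k, m_k + lam * f(m)`. -/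
noncomputable def lagrangianGradient {d : ℕ} (f : Alloc d → ℝ) (z : PrimalDual d) :
    PrimalDual d :=
  mkPD (WithLp.toLp 2 (fun _ => (1 : ℝ)) + multiplier z • gradient f (primal z)) (f (primal z))

/-- The Hessian matrix in `z = (m, lam)` of the Lagrangian `∑ k, m_k + lam * f(m)`. -/
noncomputable def lagrangianHessian {d : ℕ} (f : Alloc d → ℝ) (z : PrimalDual d) :
    Matrix (Fin d ⊕ Unit) (Fin d ⊕ Unit) ℝ :=
  Matrix.fromBlocks (multiplier z • hessMatrix f (primal z))
    (Matrix.of fun i _ => gradient f (primal z) i)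
    (Matrix.of fun _ j => gradient f (primal z) j) 0

/-- `z = (m, lam)` consists of a local solution `m` of the problem of minimizing `∑ k, m_k`
subject to `f m ≤ 0` and of a positive Lagrange multiplier `lam` for it: the first-order
conditions hold, with the constraint active. -/
structure IsPrimalDualSolution {d : ℕ} (f : Alloc d → ℝ) (z : PrimalDual d) : Prop where
  isLocalMin : primal z ∈ {m | f m ≤ 0} ∧
    IsLocalMinOn (fun m : Alloc d => ∑ k, m k) {m | f m ≤ 0} (primal z)
  multiplier_pos : 0 < multiplier z
  stationary : lagrangianGradient f z = 0

/-- The strong second-order sufficient condition at `m`: the Hessian of the constraint function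
is positive definite on the tangent space of the constraint. -/
def SSOSC {d : ℕ} (f : Alloc d → ℝ) (m : Alloc d) : Prop :=
  ∀ a : Alloc d, a ≠ 0 → inner ℝ (gradient f m) a = 0 → 0 < inner ℝ a (hess f m a)

/-- The map `m ↦ ∇ f(m)` is differentiable at `m₀` (so it is defined in a neighbourhood). -/
def GradDifferentiableAt {d : ℕ} (f : Alloc d → ℝ) (m₀ : Alloc d) : Prop :=
  (∀ᶠ m in 𝓝 m₀, DifferentiableAt ℝ f m) ∧ DifferentiableAt ℝ (gradient f) m₀

/-- The map `m ↦ ∇² f(m)` is continuous at `m₀` (so it is defined in a neighbourhood). -/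
def HessContinuousAt {d : ℕ} (f : Alloc d → ℝ) (m₀ : Alloc d) : Prop :=
  (∀ᶠ m in 𝓝 m₀, GradDifferentiableAt f m) ∧ ContinuousAt (hess f) m₀

/-- Integrable random variables dominate the loss and its first two derivatives on `M`. -/
def IntegrablyDominated {d : ℕ} {Ω : Type*} [MeasurableSpace Ω] (μ : Measure Ω)
    (loss : Alloc d → EReal) (X : Ω → Alloc d) (M : Set (Alloc d)) : Prop :=
  ∃ D₀ D₁ D₂ : Ω → ℝ, Integrable D₀ μ ∧ Integrable D₁ μ ∧ Integrable D₂ μ ∧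
    ∀ m ∈ M, ∀ᵐ ω ∂μ, |residual loss (X ω) m| ≤ D₀ ω ∧
      ‖gradient (residual loss (X ω)) m‖ ≤ D₁ ω ∧ ‖hess (residual loss (X ω)) m‖ ≤ D₂ ω

/-- Almost surely, the gradient of `m ↦ loss (X - m)` exists and is locally Lipschitz in the
interior of `M`. -/
def GradLocallyLipschitz {d : ℕ} {Ω : Type*} [MeasurableSpace Ω] (μ : Measure Ω)
    (loss : Alloc d → EReal) (X : Ω → Alloc d) (M : Set (Alloc d)) : Prop :=
  ∀ᵐ ω ∂μ, (∀ m ∈ interior M, DifferentiableAt ℝ (residual loss (X ω)) m) ∧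
    LocallyLipschitzOn (interior M) (gradient (residual loss (X ω)))

/-- The gradient of the sample Lagrangian `∑ k, m_k + lam * g_N(m)`, as the average of the
gradients of the Lagrangians of the sample points. -/
noncomputable def sampleLagrangianGradient {d : ℕ} (loss : Alloc d → EReal) (x : ℕ → Alloc d)
    (N : ℕ) (z : PrimalDual d) : PrimalDual d :=
  (N : ℝ)⁻¹ • ∑ i ∈ Finset.range N, lagrangianGradient (residual loss (x i)) z

/-- `z = (m, lam)` is a solution in `M × (0, lamBar]` of the sample average approximation:
`m` minimizes `∑ k, m_k` over the `m ∈ M` with `g_N(m) ≤ 0`, and `z` satisfies the first-order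
conditions. -/
structure IsSAASolution {d : ℕ} (loss : Alloc d → EReal) (M : Set (Alloc d)) (lamBar : ℝ)
    (x : ℕ → Alloc d) (N : ℕ) (z : PrimalDual d) : Prop where
  primal_mem : primal z ∈ M
  multiplier_mem : multiplier z ∈ Set.Ioc 0 lamBar
  feasible : sampleLoss loss x N (primal z) ≤ 0
  isMin : ∀ m ∈ M, sampleLoss loss x N m ≤ 0 → ∑ k, primal z k ≤ ∑ k, m k
  stationary : sampleLagrangianGradient loss x N z = 0

/-- The covariance matrix `H(z)` of the gradient at `z` of the Lagrangian
`∑ k, m_k + lam * loss (X - m)`. -/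
noncomputable def gradientCovariance {d : ℕ} {Ω : Type*} [MeasurableSpace Ω] (μ : Measure Ω)
    (loss : Alloc d → EReal) (X : Ω → Alloc d) (z : PrimalDual d) :
    Matrix (Fin d ⊕ Unit) (Fin d ⊕ Unit) ℝ :=
  Matrix.of fun i j =>
    cov[fun ω => lagrangianGradient (residual loss (X ω)) z i,
      fun ω => lagrangianGradient (residual loss (X ω)) z j; μ]

/-- The sandwich covariance matrix `V(z)`. -/
noncomputable def sandwichCovariance {d : ℕ} {Ω : Type*} [MeasurableSpace Ω] (μ : Measure Ω)
    (loss : Alloc d → EReal) (X : Ω → Alloc d) (z : PrimalDual d) :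
    Matrix (Fin d ⊕ Unit) (Fin d ⊕ Unit) ℝ :=
  (lagrangianHessian (expectedLoss μ loss X) z)⁻¹ * gradientCovariance μ loss X z *
    (lagrangianHessian (expectedLoss μ loss X) z)⁻¹

end MSRM

/-!
The chosen solution `z_N` is a zero of the sample mean `Ψ_N` of the gradients `∇L(X_i, ·)` of the
Lagrangian, so asymptotic normality is that of a Z-estimator: if `A` is the Hessian of the
Lagrangian at the exact solution `z`, then `0 = Ψ_N(z_N) = Ψ_N(z) + A (z_N - z) + o(z_N - z)`, so that
`√N (z_N - z)` equals `-A⁻¹ √N Ψ_N(z)` up to a relative error that vanishes almost surely. The central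
limit theorem (`tendstoInDistribution_influence`) and Slutsky's theorem for relative errors
(`tendstoInDistribution_of_isLittleO`) give the limit law.

The expansion holds almost surely, and has a probabilistic and a deterministic half.

The probabilistic half shows that the sample constraint functions approximate the expected loss in
the sense of `Approximates`. They converge uniformly on `M` by the law of large numbers in `C(M, ℝ)`.
Their gradients have a first-order expansion at the solution that is uniform in the sample size
(`ae_gradient_sampleLoss_expansion`). Here the Hessian of `m ↦ loss (X - m)` need not be continuous
on a neighbourhood that is independent of `X`. What serves instead is that the gradient is Lipschitz
with an integrable constant, which follows from the bound on the Hessian by Fubini's theorem on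
segments (`ae_norm_gradient_residual_sub_le`). Thus the expected relative error of the linear
approximation of the gradient tends to `0` by dominated convergence
(`tendsto_lintegral_gradientError`), and the law of large numbers applies to this error.

The deterministic half concerns programs with constraint functions that approximate `g`. The exact
solution is unique by convexity and the second-order condition
(`IsPrimalDualSolution.eq_of_sum_le`), so by compactness the solutions of the approximating programs
converge to it. They are therefore interior, and the Lagrange multiplier theorem provides multipliers,
which converge too. Hence solutions exist for large `N`, and the expansion of the first-order
conditions applies to them (`Approximates.isLittleO_lagrangianGradient`).
-/

namespace MSRM

/-! ### Limit theorems for independent copies -/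

section Limit

variable {Ω : Type*} [MeasurableSpace Ω] {μ : Measure Ω}

theorem ae_tendsto_average {E V : Type*} [MeasurableSpace E]
    [NormedAddCommGroup V] [NormedSpace ℝ V] [CompleteSpace V] [MeasurableSpace V] [BorelSpace V]
    {X : Ω → E} {Xs : ℕ → Ω → E} (hindep : iIndepFun Xs μ)
    (hident : ∀ i, IdentDistrib (Xs i) X μ μ) {F : E → V} (hF : Measurable F)
    (hint : Integrable (fun ω => F (X ω)) μ) :
    ∀ᵐ ω ∂μ, Tendsto (fun N : ℕ => (N : ℝ)⁻¹ • ∑ i ∈ Finset.range N, F (Xs i ω)) atTop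
      (𝓝 (∫ ω, F (X ω) ∂μ)) := by
  have h0 := (hident 0).comp hF
  have key := strong_law_ae (fun i => F ∘ Xs i) (h0.integrable_iff.2 hint)
    (fun i j hij => (hindep.indepFun hij).comp hF hF)
    (fun i => ((hident i).trans (hident 0).symm).comp hF)
  rw [h0.integral_eq] at key
  exact key

/-- The multivariate central limit theorem, by reduction to the one-dimensional one along every
direction `t`: weak convergence in a Euclidean space is convergence of characteristic functions. -/
theorem tendstoInDistribution_inv_sqrt_smul_sum [IsProbabilityMeasure μ] {E ι : Type*}
    [MeasurableSpace E] [Fintype ι] [DecidableEq ι] {X : Ω → E} {Xs : ℕ → Ω → E}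
    (hindep : iIndepFun Xs μ) (hident : ∀ i, IdentDistrib (Xs i) X μ μ)
    {F : E → EuclideanSpace ℝ ι} (hF : Measurable F) (hL2 : MemLp (fun ω => F (X ω)) 2 μ)
    (hmean : ∫ ω, F (X ω) ∂μ = 0) {V : Matrix ι ι ℝ} (hV : V.PosSemidef)
    (hvar : ∀ t : EuclideanSpace ℝ ι, Var[fun ω => inner ℝ t (F (X ω)); μ] = t ⬝ᵥ V.mulVec t) :
    TendstoInDistribution
      (fun (N : ℕ) ω => (√(N : ℝ))⁻¹ • ∑ i ∈ Finset.range N, F (Xs i ω)) atTop id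
      (fun _ => μ) (multivariateGaussian 0 V) := by
  have hFs (i : ℕ) : AEMeasurable (fun ω => F (Xs i ω)) μ :=
    hF.comp_aemeasurable (hident i).aemeasurable_fst
  have hmeas (N : ℕ) :
      AEMeasurable (fun ω => (√(N : ℝ))⁻¹ • ∑ i ∈ Finset.range N, F (Xs i ω)) μ :=
    (Finset.aemeasurable_fun_sum _ fun i _ => hFs i).fun_const_smul _
  refine ⟨hmeas, aemeasurable_id, ?_⟩
  refine ProbabilityMeasure.tendsto_iff_tendsto_charFun.2 fun t => ?_
  have hG : Measurable fun x => inner ℝ t (F x) := by fun_prop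
  have hG0 := (hident 0).comp hG
  have hmean' : ∫ ω, inner ℝ t (F (Xs 0 ω)) ∂μ = 0 := by
    have h1 := hG0.integral_eq
    simp only [Function.comp_def] at h1
    rw [h1, integral_inner (hL2.integrable (by simp)), hmean, inner_zero_right]
  have hvar' : Var[fun ω => inner ℝ t (F (Xs 0 ω)); μ] = t ⬝ᵥ V.mulVec t := by
    rw [← hvar t]
    exact hG0.variance_eq
  have hclt := tendstoInDistribution_inv_sqrt_mul_sum_sub
    (X := fun i ω => inner ℝ t (F (Xs i ω)))
    (P' := gaussianReal 0 Var[fun ω => inner ℝ t (F (Xs 0 ω)); μ].toNNReal) (Y := id)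
    ⟨aemeasurable_id, Measure.map_id⟩
    (hG0.memLp_iff.2 (hL2.const_inner t))
    (hindep.comp (fun _ x => inner ℝ t (F x)) (fun _ => hG))
    (fun i => ((hident i).trans (hident 0).symm).comp hG)
  have h1 := ProbabilityMeasure.tendsto_iff_tendsto_charFun.1 hclt.tendsto 1
  simp only [ProbabilityMeasure.coe_mk, Measure.map_id, charFun_gaussianReal, hmean', mul_zero,
    sub_zero, hvar'] at h1 ⊢
  rw [charFun_multivariateGaussian hV]
  refine (h1.congr fun N => ?_).trans (le_of_eq ?_)
  · rw [charFun_apply, charFun_apply, integral_map, integral_map]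
    · refine integral_congr_ae (Eventually.of_forall fun ω => ?_)
      simp [inner_smul_left, sum_inner, real_inner_comm]
    · exact hmeas N
    · fun_prop
    · exact (Finset.aemeasurable_fun_sum _
        fun i _ => hG.comp_aemeasurable (hident i).aemeasurable_fst).const_mul _
    · fun_prop
  · have : 0 ≤ t ⬝ᵥ V.mulVec t := by rw [← hvar t]; exact variance_nonneg _ _
    simp [Real.coe_toNNReal _ this]

/-- Slutsky's theorem for relative errors. With `u = (Y - S) / ‖S‖`, which tends to `0`, one has
`Y = S + ‖S‖ u` up to an event that almost surely stops occurring. -/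
theorem tendstoInDistribution_of_isLittleO [IsProbabilityMeasure μ] {V Ω' : Type*}
    [NormedAddCommGroup V] [InnerProductSpace ℝ V] [SecondCountableTopology V]
    [MeasurableSpace V] [BorelSpace V] [MeasurableSpace Ω'] {ν : Measure Ω'}
    [IsProbabilityMeasure ν] {S Y : ℕ → Ω → V} {Z : Ω' → V}
    (hS : TendstoInDistribution S atTop Z (fun _ => μ) ν) (hY : ∀ N, AEMeasurable (Y N) μ)
    (hSY : ∀ᵐ ω ∂μ, (fun N => Y N ω - S N ω) =o[atTop] fun N => S N ω) :
    TendstoInDistribution Y atTop Z (fun _ => μ) ν := by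
  have hSm := hS.forall_aemeasurable
  set u : ℕ → Ω → V := fun N ω => ‖S N ω‖⁻¹ • (Y N ω - S N ω) with hu
  have hum (N : ℕ) : AEMeasurable (u N) μ := (hSm N).norm.inv.smul ((hY N).sub (hSm N))
  have hu0 : TendstoInMeasure μ u atTop (fun _ => (0 : V)) := by
    refine tendstoInMeasure_of_tendsto_ae (fun N => (hum N).aestronglyMeasurable) ?_
    filter_upwards [hSY] with ω hω
    rw [tendsto_zero_iff_norm_tendsto_zero]
    refine (hω.norm_norm.tendsto_div_nhds_zero).congr fun N => ?_
    simp [hu, norm_smul, div_eq_inv_mul]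
  have hlim := hS.continuous_comp_prodMk_of_tendstoInMeasure_const
    (g := fun p : V × V => p.1 + ‖p.1‖ • p.2) (by fun_prop) hu0 hum
  simp only [smul_zero, add_zero] at hlim
  refine tendstoInDistribution_of_tendstoInMeasure_sub Y Z hlim ?_ hY
  refine tendstoInMeasure_of_tendsto_ae (fun N => ?_) ?_
  · exact ((hY N).sub (hlim.forall_aemeasurable N)).aestronglyMeasurable
  · filter_upwards [hSY] with ω hω
    refine tendsto_const_nhds.congr' ?_
    filter_upwards [hω.eventuallyLE] with N hN
    rcases eq_or_ne (S N ω) 0 with h | h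
    · have : Y N ω = 0 := by simpa [h] using hN
      simp [h, this]
    · simp [hu, smul_smul, h]

end Limit

/-! ### The real-valued loss function -/

section Loss

variable {d : ℕ} {loss : Alloc d → EReal}

/-- The loss function with real values. For a finite loss function no information is lost. -/
noncomputable def realLoss (loss : Alloc d → EReal) : Alloc d → ℝ := fun x => (loss x).toReal

theorem residual_apply (x m : Alloc d) : residual loss x m = realLoss loss (x - m) := rfl

theorem IsLossFunction.coe_realLoss (hloss : IsLossFunction loss) (hfin : ∀ x, loss x ≠ ⊤)
    (x : Alloc d) : (realLoss loss x : EReal) = loss x :=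
  EReal.coe_toReal (hfin x) (hloss.ne_bot x)

theorem IsLossFunction.realLoss_mono (hloss : IsLossFunction loss) (hfin : ∀ x, loss x ≠ ⊤)
    {x y : Alloc d} (h : ∀ k, y k ≤ x k) : realLoss loss y ≤ realLoss loss x := by
  have := hloss.mono x y h
  rwa [← hloss.coe_realLoss hfin, ← hloss.coe_realLoss hfin, EReal.coe_le_coe_iff] at this

theorem IsLossFunction.convexOn_realLoss (hloss : IsLossFunction loss) (hfin : ∀ x, loss x ≠ ⊤) :
    ConvexOn ℝ Set.univ (realLoss loss) := by
  refine ⟨convex_univ, fun x _ y _ a b ha hb hab => ?_⟩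
  have := hloss.convex x y a b ha hb hab
  rw [← hloss.coe_realLoss hfin, ← hloss.coe_realLoss hfin, ← hloss.coe_realLoss hfin] at this
  exact_mod_cast this

theorem IsLossFunction.continuous_realLoss (hloss : IsLossFunction loss)
    (hfin : ∀ x, loss x ≠ ⊤) : Continuous (realLoss loss) :=
  continuousOn_univ.1 ((hloss.convexOn_realLoss hfin).continuousOn isOpen_univ)

theorem IsLossFunction.exists_sum_sub_le_realLoss (hloss : IsLossFunction loss)
    (hfin : ∀ x, loss x ≠ ⊤) : ∃ c : ℝ, ∀ x : Alloc d, ∑ k, x k - c ≤ realLoss loss x := by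
  obtain ⟨c, hc⟩ := hloss.lower
  refine ⟨c, fun x => ?_⟩
  have := hc x
  rwa [← hloss.coe_realLoss hfin, EReal.coe_le_coe_iff] at this

theorem continuous_absVec_smul (t : ℝ) : Continuous fun x : Alloc d => absVec (t • x) := by
  unfold absVec
  fun_prop

theorem convexOn_residual (hloss : IsLossFunction loss) (hfin : ∀ x, loss x ≠ ⊤) (x : Alloc d) :
    ConvexOn ℝ Set.univ (residual loss x) := by
  refine ⟨convex_univ, fun m _ m' _ a b ha hb hab => ?_⟩
  have := (hloss.convexOn_realLoss hfin).2 (Set.mem_univ (x - m)) (Set.mem_univ (x - m')) ha hb hab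
  rw [residual_apply, show x - (a • m + b • m') = a • (x - m) + b • (x - m') by
    rw [smul_sub, smul_sub, sub_add_sub_comm, ← add_smul, hab, one_smul]]
  exact this

/-- Locally uniformly in `m`, the loss `realLoss loss (x - m)` is dominated by `realLoss loss |2 x|`
up to a constant: from above by monotonicity and convexity, from below by the lower bound
`∑ k, x k - c`. -/
theorem IsLossFunction.exists_abs_residual_le (hloss : IsLossFunction loss)
    (hfin : ∀ x, loss x ≠ ⊤) (R : ℝ) : ∃ C : ℝ, ∀ x m : Alloc d, ‖m‖ ≤ R →
      |residual loss x m| ≤ realLoss loss (absVec ((2 : ℝ) • x)) + C := by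
  obtain ⟨c, hc⟩ := hloss.exists_sum_sub_le_realLoss hfin
  set e : Alloc d := WithLp.toLp 2 (fun _ => 2 * R) with he
  refine ⟨|realLoss loss e| + 2 * |c| + d * R, fun x m hm => ?_⟩
  have hR : 0 ≤ R := (norm_nonneg m).trans hm
  have hmk (k : Fin d) : |m k| ≤ R := (PiLp.norm_apply_le m k).trans hm
  set v := realLoss loss (absVec ((2 : ℝ) • x)) with hv
  have hv1 : 2 * ∑ k, |x k| - c ≤ v := by
    have := hc (absVec ((2 : ℝ) • x))
    simpa [hv, absVec, abs_mul, Finset.mul_sum] using this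
  have hx0 : 0 ≤ ∑ k, |x k| := Finset.sum_nonneg fun k _ => abs_nonneg _
  have hup : realLoss loss (x - m) ≤ 1 / 2 * v + 1 / 2 * realLoss loss e := by
    have h1 := (hloss.convexOn_realLoss hfin).2 (Set.mem_univ (absVec ((2 : ℝ) • x)))
      (Set.mem_univ e) (by norm_num : (0 : ℝ) ≤ 1 / 2) (by norm_num : (0 : ℝ) ≤ 1 / 2)
      (by norm_num)
    refine (hloss.realLoss_mono hfin fun k => ?_).trans h1
    have h2 := (abs_le.1 (hmk k)).1
    have h3 := le_abs_self (x k)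
    simp [absVec, he, abs_mul]
    linarith
  have hlow : -(∑ k, |x k|) - d * R - c ≤ realLoss loss (x - m) := by
    refine le_trans ?_ (hc (x - m))
    have : ∑ k : Fin d, (-|x k| - R) ≤ ∑ k, (x - m) k := by
      refine Finset.sum_le_sum fun k _ => ?_
      have h2 := (abs_le.1 (hmk k)).2
      have h3 := neg_abs_le (x k)
      simp only [PiLp.sub_apply]
      linarith
    rw [Finset.sum_sub_distrib, Finset.sum_neg_distrib] at this
    simp only [Finset.sum_const, Finset.card_univ, Fintype.card_fin, nsmul_eq_mul] at this
    linarith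
  have hdR : (0 : ℝ) ≤ d * R := by positivity
  have h4 := le_abs_self c
  have h5 := le_abs_self (realLoss loss e)
  have h6 := abs_nonneg (realLoss loss e)
  have h7 := neg_abs_le c
  rw [residual_apply, abs_le]
  constructor <;> linarith

/-- On bounded sets of allocations `m ↦ loss (x - m)` is Lipschitz, with a constant controlled
by `realLoss loss |2 x|`, because convex functions are Lipschitz where they are bounded. -/
theorem IsLossFunction.exists_lipschitzOnWith_residual (hloss : IsLossFunction loss)
    (hfin : ∀ x, loss x ≠ ⊤) (R : ℝ) : ∃ C : ℝ, ∀ x : Alloc d,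
      LipschitzOnWith (2 * (realLoss loss (absVec ((2 : ℝ) • x)) + C)).toNNReal (residual loss x)
        (Metric.ball 0 R) := by
  obtain ⟨C, hC⟩ := hloss.exists_abs_residual_le hfin (R + 1)
  refine ⟨C, fun x => ?_⟩
  have := ((convexOn_residual hloss hfin x).subset (Set.subset_univ _)
    (convex_ball (0 : Alloc d) (R + 1))).lipschitzOnWith_of_abs_le one_pos
    (fun m hm => hC x m (by rw [dist_zero_right] at hm; exact hm.le))
  simpa using this

variable {Ω : Type*} [MeasurableSpace Ω] {μ : Measure Ω} {X : Ω → Alloc d}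

/-- Under a density all coordinates of `X` are almost surely nonzero, so that the vectors
`n • |X|`, at which the loss is finite, eventually exceed any given vector. -/
theorem IsLossFunction.ne_top [IsProbabilityMeasure μ] (hloss : IsLossFunction loss)
    (hpdf : HasPDF X μ volume) (hX : InOrliczHeart μ loss X) (x : Alloc d) : loss x ≠ ⊤ := by
  have hne : ∀ᵐ ω ∂μ, ∀ k, X ω k ≠ 0 := by
    rw [ae_all_iff]
    intro k
    have h1 : ∀ᵐ y : Alloc d, y k ≠ 0 := by
      have h2 := Measure.addHaar_submodule (volume : Measure (Alloc d))
        (LinearMap.ker (EuclideanSpace.proj (𝕜 := ℝ) k : Alloc d →L[ℝ] ℝ).toLinearMap) (by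
          intro h
          have : EuclideanSpace.single k (1 : ℝ) ∈ (⊤ : Submodule ℝ (Alloc d)) := trivial
          rw [← h] at this
          simp at this)
      rw [ae_iff]
      convert! h2 using 2
      ext y
      simp
    exact ae_of_ae_map hX.1 (hpdf.absolutelyContinuous'.ae_le h1)
  have hfin : ∀ᵐ ω ∂μ, ∀ n : ℕ, loss (absVec ((n + 1 : ℝ) • X ω)) < ⊤ := by
    rw [ae_all_iff]
    intro n
    have hmeas : Measurable fun y : Alloc d => (loss (absVec ((n + 1 : ℝ) • y))).toENNReal :=
      (hloss.lsc.measurable.comp (continuous_absVec_smul _).measurable).ereal_toENNReal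
    filter_upwards [ae_lt_top' (hmeas.comp_aemeasurable hX.1)
      (hX.2 (n + 1) (by positivity)).ne] with ω hω
    simp only [Function.comp_apply] at hω
    rw [lt_top_iff_ne_top] at hω ⊢
    intro h
    exact hω (by simp [h])
  obtain ⟨ω, h1, h2⟩ := (hne.and hfin).exists
  obtain ⟨n, hn⟩ : ∃ n : ℕ, ∀ k, x k / |X ω k| ≤ n := by
    obtain ⟨n, hn⟩ := exists_nat_ge (∑ k, |(x k / |X ω k| : ℝ)|)
    refine ⟨n, fun k => (le_abs_self _).trans (le_trans ?_ hn)⟩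
    exact Finset.single_le_sum (f := fun k => |(x k / |X ω k| : ℝ)|) (fun _ _ => abs_nonneg _)
      (Finset.mem_univ k)
  refine ((hloss.mono (absVec ((n + 1 : ℝ) • X ω)) x fun k => ?_).trans_lt (h2 n)).ne
  have h3 : 0 < |X ω k| := abs_pos.2 (h1 k)
  have h4 := (div_le_iff₀ h3).1 (hn k)
  have h5 : |(n + 1 : ℝ)| = n + 1 := abs_of_pos (by positivity)
  simp only [absVec, PiLp.smul_apply, smul_eq_mul, abs_mul, h5]
  linarith

theorem InOrliczHeart.integrable_realLoss [IsFiniteMeasure μ] (hX : InOrliczHeart μ loss X)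
    (hloss : IsLossFunction loss) (hfin : ∀ x, loss x ≠ ⊤) :
    Integrable (fun ω => realLoss loss (absVec ((2 : ℝ) • X ω))) μ := by
  obtain ⟨C, hC⟩ := hloss.exists_abs_residual_le hfin 0
  have hnn (y : Alloc d) : 0 ≤ realLoss loss (absVec ((2 : ℝ) • y)) + C :=
    (abs_nonneg _).trans (hC y 0 (by simp))
  have hm : AEMeasurable (fun ω => realLoss loss (absVec ((2 : ℝ) • X ω))) μ :=
    ((hloss.continuous_realLoss hfin).comp (continuous_absVec_smul 2)).measurable.comp_aemeasurable
      hX.1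
  have h1 : Integrable (fun ω => realLoss loss (absVec ((2 : ℝ) • X ω)) + C) μ := by
    refine ⟨(hm.add_const C).aestronglyMeasurable, ?_⟩
    rw [hasFiniteIntegral_iff_ofReal (Eventually.of_forall fun ω => hnn _)]
    calc ∫⁻ ω, ENNReal.ofReal (realLoss loss (absVec ((2 : ℝ) • X ω)) + C) ∂μ
        ≤ ∫⁻ ω, ((loss (absVec ((2 : ℝ) • X ω))).toENNReal + ENNReal.ofReal C) ∂μ := by
          refine lintegral_mono fun ω => ENNReal.ofReal_add_le.trans ?_
          rw [← hloss.coe_realLoss hfin]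
          simp
      _ < ⊤ := by
          rw [lintegral_add_right _ measurable_const]
          exact ENNReal.add_lt_top.2 ⟨hX.2 2 two_pos, by simp [ENNReal.mul_lt_top]⟩
  exact (integrable_add_const_iff).1 h1

end Loss

/-! ### Derivatives of the residual loss -/

section Derivative

variable {d : ℕ} {loss : Alloc d → EReal}

theorem fderiv_comp_const_sub {E F : Type*} [NormedAddCommGroup E] [NormedSpace ℝ E]
    [NormedAddCommGroup F] [NormedSpace ℝ F] (f : E → F) (x m : E) :
    fderiv ℝ (fun m => f (x - m)) m = -fderiv ℝ f (x - m) := by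
  have h1 : (fun m => f (x - m)) = fun m => (f ∘ ContinuousLinearEquiv.neg ℝ) (m - x) := by
    ext m
    simp
  rw [h1, fderiv_comp_sub, ContinuousLinearEquiv.comp_right_fderiv]
  ext v
  simp

theorem differentiableAt_comp_const_sub {E F : Type*} [NormedAddCommGroup E] [NormedSpace ℝ E]
    [NormedAddCommGroup F] [NormedSpace ℝ F] {f : E → F} {x m : E} :
    DifferentiableAt ℝ (fun m => f (x - m)) m ↔ DifferentiableAt ℝ f (x - m) := by
  refine ⟨fun h => ?_, fun h => h.comp m (by fun_prop)⟩
  have h1 : f = (fun m => f (x - m)) ∘ fun y => x - y := by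
    ext y
    simp
  rw [h1]
  refine DifferentiableAt.comp _ ?_ (by fun_prop)
  simpa using h

theorem gradient_residual (x : Alloc d) :
    gradient (residual loss x) = fun m => -gradient (realLoss loss) (x - m) := by
  ext1 m
  have := fderiv_comp_const_sub (realLoss loss) x m
  unfold gradient
  rw [← map_neg, ← this]
  rfl

theorem hess_residual (x m : Alloc d) :
    hess (residual loss x) m = fderiv ℝ (gradient (realLoss loss)) (x - m) := by
  rw [hess, gradient_residual]
  have := fderiv_comp_const_sub (gradient (realLoss loss)) x m
  rw [fderiv_fun_neg, this, neg_neg]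

theorem differentiableAt_residual {x m : Alloc d} :
    DifferentiableAt ℝ (residual loss x) m ↔ DifferentiableAt ℝ (realLoss loss) (x - m) :=
  differentiableAt_comp_const_sub (f := realLoss loss)

theorem differentiableAt_gradient_residual {x m : Alloc d} :
    DifferentiableAt ℝ (gradient (residual loss x)) m ↔
      DifferentiableAt ℝ (gradient (realLoss loss)) (x - m) := by
  rw [gradient_residual]
  refine Iff.trans ?_ differentiableAt_comp_const_sub
  exact ⟨fun h => by simpa using h.fun_neg, fun h => h.fun_neg⟩

theorem measurable_gradient (f : Alloc d → ℝ) : Measurable (gradient f) :=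
  (InnerProductSpace.toDual ℝ (Alloc d)).symm.continuous.measurable.comp (measurable_fderiv ℝ f)

theorem measurable_gradient_residual (m : Alloc d) :
    Measurable fun x => gradient (residual loss x) m := by
  simp only [gradient_residual]
  exact ((measurable_gradient _).comp (measurable_id.sub_const m)).neg

theorem measurable_hess_residual (m : Alloc d) :
    Measurable fun x => hess (residual loss x) m := by
  simp only [hess_residual]
  exact (measurable_fderiv ℝ _).comp (measurable_id.sub_const m)

theorem inner_gradient (f : Alloc d → ℝ) (m v : Alloc d) :
    inner ℝ (gradient f m) v = fderiv ℝ f m v := by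
  rw [gradient, InnerProductSpace.toDual_symm_apply]

end Derivative

/-! ### The expected loss -/

section Expectation

variable {d : ℕ} {loss : Alloc d → EReal} {Ω : Type*} [MeasurableSpace Ω] {μ : Measure Ω}
  {X : Ω → Alloc d}

theorem measurable_residual (hloss : IsLossFunction loss) (hfin : ∀ x, loss x ≠ ⊤) (m : Alloc d) :
    Measurable fun x => residual loss x m :=
  ((hloss.continuous_realLoss hfin).comp (continuous_id.sub continuous_const)).measurable

theorem integrable_residual [IsFiniteMeasure μ] (hloss : IsLossFunction loss)
    (hfin : ∀ x, loss x ≠ ⊤) (hX : InOrliczHeart μ loss X) (m : Alloc d) :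
    Integrable (fun ω => residual loss (X ω) m) μ := by
  obtain ⟨C, hC⟩ := hloss.exists_abs_residual_le hfin ‖m‖
  refine ((hX.integrable_realLoss hloss hfin).add (integrable_const C)).mono'
    ((measurable_residual hloss hfin m).comp_aemeasurable hX.1).aestronglyMeasurable ?_
  exact Eventually.of_forall fun ω => hC _ _ le_rfl

theorem convexOn_expectedLoss [IsFiniteMeasure μ] (hloss : IsLossFunction loss)
    (hfin : ∀ x, loss x ≠ ⊤) (hX : InOrliczHeart μ loss X) :
    ConvexOn ℝ Set.univ (expectedLoss μ loss X) := by
  refine ⟨convex_univ, fun m _ m' _ a b ha hb hab => ?_⟩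
  have hi := integrable_residual hloss hfin hX
  have h1 : ∫ ω, residual loss (X ω) (a • m + b • m') ∂μ ≤
      ∫ ω, (a * residual loss (X ω) m + b * residual loss (X ω) m') ∂μ :=
    integral_mono (hi _) (((hi m).const_mul a).add ((hi m').const_mul b)) fun ω =>
      (convexOn_residual hloss hfin (X ω)).2 (Set.mem_univ m) (Set.mem_univ m') ha hb hab
  rwa [integral_add ((hi m).const_mul a) ((hi m').const_mul b), integral_const_mul,
    integral_const_mul] at h1

/-- Differentiation under the expectation. -/
theorem hasGradientAt_expectedLoss [IsFiniteMeasure μ] (hloss : IsLossFunction loss)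
    (hfin : ∀ x, loss x ≠ ⊤) (hX : InOrliczHeart μ loss X) {m : Alloc d}
    (hdiff : ∀ᵐ ω ∂μ, DifferentiableAt ℝ (residual loss (X ω)) m) :
    Integrable (fun ω => gradient (residual loss (X ω)) m) μ ∧
      HasGradientAt (expectedLoss μ loss X) (∫ ω, gradient (residual loss (X ω)) m ∂μ) m := by
  obtain ⟨C, hC⟩ := hloss.exists_lipschitzOnWith_residual hfin (‖m‖ + 1)
  have hgm : AEStronglyMeasurable (fun ω => gradient (residual loss (X ω)) m) μ :=
    ((measurable_gradient_residual m).comp_aemeasurable hX.1).aestronglyMeasurable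
  have hfm : AEStronglyMeasurable (fun ω => fderiv ℝ (residual loss (X ω)) m) μ := by
    have := (InnerProductSpace.toDual ℝ (Alloc d)).continuous.comp_aestronglyMeasurable hgm
    simpa only [toDual_gradient] using this
  obtain ⟨h1, h2⟩ := hasFDerivAt_integral_of_dominated_loc_of_lip (𝕜 := ℝ) (μ := μ)
    (F := fun m ω => residual loss (X ω) m) (x₀ := m) (s := Metric.ball 0 (‖m‖ + 1))
    (F' := fun ω => fderiv ℝ (residual loss (X ω)) m)
    (bound := fun ω => 2 * (realLoss loss (absVec ((2 : ℝ) • X ω)) + C))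
    (Metric.isOpen_ball.mem_nhds (by simp))
    (Eventually.of_forall fun m' => (integrable_residual hloss hfin hX m').aestronglyMeasurable)
    (integrable_residual hloss hfin hX m) hfm
    (Eventually.of_forall fun ω => (hC (X ω)).weaken (by
      rw [← NNReal.coe_le_coe, Real.coe_nnabs, Real.coe_toNNReal']
      exact max_le (le_abs_self _) (abs_nonneg _)))
    (((hX.integrable_realLoss hloss hfin).add (integrable_const C)).const_mul 2)
    (hdiff.mono fun ω hω => hω.hasFDerivAt)
  have hint : Integrable (fun ω => gradient (residual loss (X ω)) m) μ :=
    h1.norm.mono' hgm (Eventually.of_forall fun ω => by simp [gradient])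
  refine ⟨hint, ?_⟩
  rw [hasGradientAt_iff_hasFDerivAt]
  convert! h2 using 1
  ext v
  rw [InnerProductSpace.toDual_apply_apply, ContinuousLinearMap.integral_apply h1,
    real_inner_comm, ← integral_inner hint]
  refine integral_congr_ae (Eventually.of_forall fun ω => ?_)
  simp only [← inner_gradient]
  exact real_inner_comm _ _

/-- The uniform law of large numbers for the constraint function on a compact set `M`: the strong
law of large numbers in the Banach space `C(M, ℝ)`. -/
theorem ae_tendstoUniformlyOn_sampleLoss [IsFiniteMeasure μ] (hloss : IsLossFunction loss)
    (hfin : ∀ x, loss x ≠ ⊤) (hX : InOrliczHeart μ loss X) {Xs : ℕ → Ω → Alloc d}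
    (hindep : iIndepFun Xs μ) (hident : ∀ i, IdentDistrib (Xs i) X μ μ) {M : Set (Alloc d)}
    (hM : IsCompact M) :
    ∀ᵐ ω ∂μ, TendstoUniformlyOn (fun N => sampleLoss loss (fun i => Xs i ω) N)
      (expectedLoss μ loss X) atTop M := by
  rcases M.eq_empty_or_nonempty with rfl | ⟨m₀, hm₀⟩
  · exact Eventually.of_forall fun ω => tendstoUniformlyOn_empty
  have : CompactSpace M := isCompact_iff_compactSpace.1 hM
  let Φ : C(Alloc d, C(M, ℝ)) := ContinuousMap.curry
    ⟨fun p : Alloc d × M => realLoss loss (p.1 - p.2),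
      (hloss.continuous_realLoss hfin).comp (by fun_prop)⟩
  let _ : MeasurableSpace C(M, ℝ) := borel _
  have : BorelSpace C(M, ℝ) := ⟨rfl⟩
  obtain ⟨R, hR⟩ := hM.isBounded.exists_norm_le
  obtain ⟨C, hC⟩ := hloss.exists_abs_residual_le hfin R
  have hint : Integrable (fun ω => Φ (X ω)) μ := by
    refine ((hX.integrable_realLoss hloss hfin).add (integrable_const C)).mono'
      (Φ.continuous.comp_aestronglyMeasurable hX.1.aestronglyMeasurable) ?_
    refine Eventually.of_forall fun ω => (ContinuousMap.norm_le _ ?_).2 fun m => ?_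
    · exact (abs_nonneg _).trans (hC (X ω) m₀ (hR m₀ hm₀))
    · exact hC (X ω) m (hR m m.2)
  filter_upwards [ae_tendsto_average hindep hident Φ.continuous.measurable hint] with ω hω
  rw [ContinuousMap.tendsto_iff_tendstoUniformly] at hω
  rw [tendstoUniformlyOn_iff_tendstoUniformly_comp_coe]
  convert! hω using 1
  · ext N m
    simp [sampleLoss, Φ, residual_apply]
  · ext m
    have := (ContinuousMap.evalCLM ℝ m).integral_comp_comm hint
    exact this

end Expectation

/-! ### Lipschitz continuity of the gradient of the residual loss -/

section Lipschitz

/-- A Lipschitz curve whose speed is almost everywhere at most `C` moves by at most `C` in unit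
time: fundamental theorem of calculus for the component along the displacement. -/
theorem norm_sub_le_of_ae_norm_deriv_le {V : Type*} [NormedAddCommGroup V] [InnerProductSpace ℝ V]
    {φ : ℝ → V} {K : NNReal} {C : ℝ} (hφ : LipschitzOnWith K φ (Set.Icc 0 1))
    (hd : ∀ᵐ t ∂(volume.restrict (Set.Icc (0 : ℝ) 1)),
      ∃ v, HasDerivAt φ v t ∧ ‖v‖ ≤ C) : ‖φ 1 - φ 0‖ ≤ C := by
  set e := φ 1 - φ 0 with he
  have hψ : LipschitzOnWith (‖innerSL ℝ e‖₊ * K) (fun t => inner ℝ e (φ t)) (Set.Icc 0 1) :=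
    (innerSL ℝ e).lipschitz.comp_lipschitzOnWith hφ
  rw [← Set.uIcc_of_le zero_le_one] at hψ
  have hint := hψ.absolutelyContinuousOnInterval.integral_deriv_eq_sub
  rw [← inner_sub_right, ← he, real_inner_self_eq_norm_mul_norm] at hint
  have hbound : ‖∫ t in (0 : ℝ)..1, deriv (fun t => inner ℝ e (φ t)) t‖ ≤
      ‖e‖ * C * |(1 : ℝ) - 0| := by
    refine intervalIntegral.norm_integral_le_of_norm_le_const_ae ?_
    rw [ae_restrict_iff' measurableSet_Icc] at hd
    filter_upwards [hd] with t ht hmem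
    rw [Set.uIoc_of_le zero_le_one] at hmem
    obtain ⟨v, hv, hvC⟩ := ht (Set.Ioc_subset_Icc_self hmem)
    have h1 : HasDerivAt (fun t => inner ℝ e (φ t)) (inner ℝ e v) t :=
      (innerSL ℝ e).hasFDerivAt.comp_hasDerivAt t hv
    rw [h1.deriv]
    exact (norm_inner_le_norm e v).trans (by gcongr)
  rw [hint, sub_zero, abs_one, mul_one, Real.norm_of_nonneg (by positivity)] at hbound
  rcases (norm_nonneg e).eq_or_lt with h | h
  · rw [← h]
    have : (volume.restrict (Set.Icc (0 : ℝ) 1)) ≠ 0 := by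
      intro h0
      have := congrArg (fun ν : Measure ℝ => ν Set.univ) h0
      simp at this
    have : (ae (volume.restrict (Set.Icc (0 : ℝ) 1))).NeBot := ae_neBot.2 this
    obtain ⟨t, v, -, hv⟩ := hd.exists
    exact (norm_nonneg v).trans hv
  · exact le_of_mul_le_mul_left hbound h

theorem forall_mem_le_of_dense {E : Type*} [TopologicalSpace E] {U D : Set E} (hU : IsOpen U)
    (hD : Dense D) {f g : E → ℝ} (hf : ContinuousOn f U) (hg : ContinuousOn g U)
    (h : ∀ q ∈ U ∩ D, f q ≤ g q) : ∀ q ∈ U, f q ≤ g q := fun q hq =>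
  ContinuousWithinAt.closure_le (hD.open_subset_closure_inter hU hq)
    ((hf q hq).mono Set.inter_subset_left) ((hg q hq).mono Set.inter_subset_left) h

variable {d : ℕ} {loss : Alloc d → EReal} {Ω : Type*} [MeasurableSpace Ω] {μ : Measure Ω}
  {X : Ω → Alloc d} {M : Set (Alloc d)} {D₂ : Ω → ℝ}

/-- By Fubini's theorem, almost surely the bound on the Hessian holds almost everywhere on the
segment from `p` to `q`, so it bounds the increment of the gradient. -/
theorem ae_norm_gradient_residual_sub_le [IsFiniteMeasure μ] (hX : AEMeasurable X μ)
    (hdiff : ∀ m₀, ∀ᵐ ω ∂μ, GradDifferentiableAt (residual loss (X ω)) m₀)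
    (hlip : GradLocallyLipschitz μ loss X M) (hD₂ : AEMeasurable D₂ μ)
    (hdom : ∀ m ∈ M, ∀ᵐ ω ∂μ, ‖hess (residual loss (X ω)) m‖ ≤ D₂ ω) {p q : Alloc d}
    (hpq : segment ℝ p q ⊆ interior M) :
    ∀ᵐ ω ∂μ, ‖gradient (residual loss (X ω)) q - gradient (residual loss (X ω)) p‖ ≤
      D₂ ω * ‖q - p‖ := by
  set γ : ℝ → Alloc d := fun t => AffineMap.lineMap p q t with hγ
  have hγM {t : ℝ} (ht : t ∈ Set.Icc (0 : ℝ) 1) : γ t ∈ segment ℝ p q := by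
    rw [segment_eq_image_lineMap]
    exact ⟨t, ht, rfl⟩
  have hγc : Continuous γ := AffineMap.lineMap_continuous
  set G := gradient (realLoss loss) with hG
  let P : Ω → ℝ → Prop := fun ω t => DifferentiableAt ℝ G (hX.mk X ω - γ t) ∧
    ‖fderiv ℝ G (hX.mk X ω - γ t)‖ ≤ hD₂.mk D₂ ω
  have hm : Measurable fun z : Ω × ℝ => hX.mk X z.1 - γ z.2 :=
    (hX.measurable_mk.comp measurable_fst).sub (hγc.measurable.comp measurable_snd)
  have hP : MeasurableSet {z : Ω × ℝ | P z.1 z.2} :=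
    (hm (measurableSet_of_differentiableAt ℝ G)).inter
      (measurableSet_le ((measurable_fderiv ℝ G).comp hm).norm
        (hD₂.measurable_mk.comp measurable_fst))
  have hfub : ∀ᵐ ω ∂μ, ∀ᵐ t ∂(volume.restrict (Set.Icc (0 : ℝ) 1)), P ω t := by
    rw [Measure.ae_ae_comm hP, ae_restrict_iff' measurableSet_Icc]
    refine Eventually.of_forall fun t ht => ?_
    filter_upwards [hX.ae_eq_mk, hD₂.ae_eq_mk, hdiff (γ t),
      hdom (γ t) (interior_subset (hpq (hγM ht)))] with ω h1 h2 h3 h4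
    rw [hess_residual, h1, h2] at h4
    have h5 := differentiableAt_gradient_residual.1 h3.2
    rw [h1] at h5
    exact ⟨h5, h4⟩
  filter_upwards [hfub, hX.ae_eq_mk, hD₂.ae_eq_mk, hlip] with ω hω h1 h2 h3
  obtain ⟨K, hK⟩ := (h3.2.mono hpq).exists_lipschitzOnWith_of_compact (by
    rw [segment_eq_image_lineMap]
    exact isCompact_Icc.image hγc)
  have hlipγ := hK.comp (lipschitzWith_lineMap p q).lipschitzOnWith
    (fun t ht => hγM ht : Set.MapsTo γ (Set.Icc 0 1) _)
  have key := norm_sub_le_of_ae_norm_deriv_le (C := D₂ ω * ‖q - p‖) hlipγ (by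
    filter_upwards [hω] with t ht
    have h5 : HasFDerivAt (gradient (residual loss (X ω))) (hess (residual loss (X ω)) (γ t))
        (γ t) := by
      refine (differentiableAt_gradient_residual.2 ?_).hasFDerivAt
      rw [h1]
      exact ht.1
    refine ⟨_, h5.comp_hasDerivAt t AffineMap.hasDerivAt_lineMap, ?_⟩
    refine (ContinuousLinearMap.le_opNorm _ _).trans ?_
    rw [hess_residual, h1, h2]
    exact mul_le_mul_of_nonneg_right ht.2 (norm_nonneg _))
  simpa [hγ] using key

theorem ae_forall_norm_gradient_residual_sub_le [IsFiniteMeasure μ] (hX : AEMeasurable X μ)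
    (hdiff : ∀ m₀, ∀ᵐ ω ∂μ, GradDifferentiableAt (residual loss (X ω)) m₀)
    (hlip : GradLocallyLipschitz μ loss X M) (hD₂ : AEMeasurable D₂ μ)
    (hdom : ∀ m ∈ M, ∀ᵐ ω ∂μ, ‖hess (residual loss (X ω)) m‖ ≤ D₂ ω) {p : Alloc d} {r : ℝ}
    (hr : 0 < r) (hpr : Metric.ball p r ⊆ interior M) :
    ∀ᵐ ω ∂μ, ∀ q ∈ Metric.ball p r,
      ‖gradient (residual loss (X ω)) q - gradient (residual loss (X ω)) p‖ ≤
        D₂ ω * ‖q - p‖ := by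
  obtain ⟨D, hDc, hDd⟩ := TopologicalSpace.exists_countable_dense (Alloc d)
  have hall : ∀ᵐ ω ∂μ, ∀ q ∈ D, q ∈ Metric.ball p r →
      ‖gradient (residual loss (X ω)) q - gradient (residual loss (X ω)) p‖ ≤
        D₂ ω * ‖q - p‖ := by
    rw [ae_ball_iff hDc]
    intro q _
    by_cases hqr : q ∈ Metric.ball p r
    · refine (ae_norm_gradient_residual_sub_le hX hdiff hlip hD₂ hdom ?_).mono fun ω h _ => h
      exact ((convex_ball p r).segment_subset (Metric.mem_ball_self hr) hqr).trans hpr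
    · exact Eventually.of_forall fun ω h => absurd h hqr
  filter_upwards [hall, hlip] with ω hω h3
  have hc := h3.2.continuousOn.mono hpr
  exact forall_mem_le_of_dense Metric.isOpen_ball hDd (hc.sub continuousOn_const).norm
    (by fun_prop) fun q hq => hω q hq.2 hq.1

/-- The Hessian of the expected loss is the expected Hessian of the residual loss. -/
theorem hasFDerivAt_gradient_expectedLoss [IsFiniteMeasure μ] (hloss : IsLossFunction loss)
    (hfin : ∀ x, loss x ≠ ⊤) (hX : InOrliczHeart μ loss X)
    (hdiff : ∀ m₀, ∀ᵐ ω ∂μ, GradDifferentiableAt (residual loss (X ω)) m₀)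
    (hlip : GradLocallyLipschitz μ loss X M) (hD₂ : Integrable D₂ μ)
    (hdom : ∀ m ∈ M, ∀ᵐ ω ∂μ, ‖hess (residual loss (X ω)) m‖ ≤ D₂ ω) {p : Alloc d}
    (hp : p ∈ interior M) :
    HasFDerivAt (gradient (expectedLoss μ loss X)) (∫ ω, hess (residual loss (X ω)) p ∂μ) p := by
  obtain ⟨r, hr, hpr⟩ := Metric.isOpen_iff.1 isOpen_interior p hp
  have hgrad (m : Alloc d) := hasGradientAt_expectedLoss (m := m) hloss hfin hX
    ((hdiff m).mono fun ω h => h.1.self_of_nhds)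
  have heq : gradient (expectedLoss μ loss X) =
      fun m => ∫ ω, gradient (residual loss (X ω)) m ∂μ := gradient_eq fun m => (hgrad m).2
  rw [heq]
  refine (hasFDerivAt_integral_of_dominated_loc_of_lip' (𝕜 := ℝ) (μ := μ)
    (F := fun m ω => gradient (residual loss (X ω)) m) (Metric.ball_mem_nhds p hr)
    (fun m _ => (hgrad m).1.aestronglyMeasurable) (hgrad p).1
    ((measurable_hess_residual p).comp_aemeasurable hX.1).aestronglyMeasurable
    (ae_forall_norm_gradient_residual_sub_le hX.1 hdiff hlip hD₂.aemeasurable hdom hr hpr) hD₂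
    ((hdiff p).mono fun ω h => h.2.hasFDerivAt)).2

end Lipschitz

/-! ### Uniform first-order expansion of the sample gradients -/

section Sample

variable {d : ℕ} {loss : Alloc d → EReal} {Ω : Type*} [MeasurableSpace Ω] {μ : Measure Ω}
  {X Y : Ω → Alloc d} {M : Set (Alloc d)} {D₂ : Ω → ℝ}

open scoped Pointwise in
/-- Continuous differentiability of the residual loss on the interior of `M` depends only on the
law of `X`: the realizations `x` for which it holds are those with `x - interior M` inside the open
set on which `realLoss loss` is continuously differentiable, and they form a closed set. -/
theorem GradLocallyLipschitz.ae_identDistrib (hlip : GradLocallyLipschitz μ loss X M)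
    (h : IdentDistrib Y X μ μ) :
    ∀ᵐ ω ∂μ, ∀ m ∈ interior M, DifferentiableAt ℝ (residual loss (Y ω)) m ∧
      ContinuousAt (gradient (residual loss (Y ω))) m := by
  set U : Set (Alloc d) := ⋃₀ {V | IsOpen V ∧ (∀ y ∈ V, DifferentiableAt ℝ (realLoss loss) y) ∧
    ContinuousOn (gradient (realLoss loss)) V} with hU
  have hUo : IsOpen U := isOpen_sUnion fun V hV => hV.1
  set T : Set (Alloc d) := {x | ∀ m ∈ interior M, x - m ∈ U} with hT
  have hTc : IsClosed T := by
    rw [hT, show {x | ∀ m ∈ interior M, x - m ∈ U} = ⋂ m ∈ interior M, (fun x => x - m) ⁻¹' U by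
      ext; simp, ← isOpen_compl_iff]
    have : (⋂ m ∈ interior M, (fun x => x - m) ⁻¹' U)ᶜ = Uᶜ + interior M := by
      ext x
      simp only [Set.mem_compl_iff, Set.mem_iInter, Set.mem_preimage, Set.mem_add, not_forall]
      constructor
      · rintro ⟨m, hm, hx⟩
        exact ⟨x - m, hx, m, hm, by simp⟩
      · rintro ⟨y, hy, m, hm, rfl⟩
        exact ⟨m, hm, by simpa using hy⟩
    rw [this]
    exact isOpen_interior.add_left
  have hXT : ∀ᵐ ω ∂μ, X ω ∈ T := by
    filter_upwards [hlip] with ω hω m hm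
    refine ⟨(fun y => X ω - y) ⁻¹' interior M,
      ⟨isOpen_interior.preimage (by fun_prop), fun y hy => ?_, ?_⟩, by simpa using hm⟩
    · have := hω.1 _ hy
      rw [differentiableAt_residual] at this
      simpa using this
    · have h1 : gradient (realLoss loss) =
          fun y => -gradient (residual loss (X ω)) (X ω - y) := by
        ext1 y
        simp [gradient_residual]
      rw [h1]
      exact (hω.2.continuousOn.comp (f := fun y => X ω - y) (by fun_prop) fun y hy => hy).neg
  filter_upwards [h.symm.ae_mem_snd hTc.measurableSet hXT] with ω hω m hm
  obtain ⟨V, ⟨hVo, hVd, hVc⟩, hmV⟩ := hω m hm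
  refine ⟨differentiableAt_residual.2 (hVd _ hmV), ?_⟩
  rw [gradient_residual]
  have h2 : ContinuousAt (gradient (realLoss loss)) (Y ω - m) := hVc.continuousAt (hVo.mem_nhds hmV)
  exact (ContinuousAt.comp (f := fun m => Y ω - m) h2 (by fun_prop)).neg

open scoped Classical in
/-- The relative error of the linear approximation at `p`, within distance `δ`, of the gradient
of the residual loss at the realization `x`. The supremum runs over a countable dense set, which
makes it measurable in `x`. The quotient is `0` at `p` itself. -/
noncomputable def gradientError (loss : Alloc d → EReal) (p : Alloc d) (δ : ℝ) (x : Alloc d) :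
    ENNReal :=
  ⨆ k : ℕ, if TopologicalSpace.denseSeq (Alloc d) k ∈ Metric.ball p δ then
    ENNReal.ofReal (‖gradient (residual loss x) (TopologicalSpace.denseSeq (Alloc d) k) -
      gradient (residual loss x) p -
      hess (residual loss x) p (TopologicalSpace.denseSeq (Alloc d) k - p)‖ /
        ‖TopologicalSpace.denseSeq (Alloc d) k - p‖) else 0

theorem measurable_gradientError (p : Alloc d) (δ : ℝ) : Measurable (gradientError loss p δ) := by
  refine Measurable.iSup fun k => ?_
  split_ifs
  · refine ENNReal.measurable_ofReal.comp (Measurable.div_const ?_ _)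
    have h1 : Measurable fun x => hess (residual loss x) p
        (TopologicalSpace.denseSeq (Alloc d) k - p) :=
      (ContinuousLinearMap.apply ℝ (Alloc d)
        (TopologicalSpace.denseSeq (Alloc d) k - p)).continuous.measurable.comp
        (measurable_hess_residual p)
    exact (((measurable_gradient_residual _).sub (measurable_gradient_residual p)).sub h1).norm
  · exact measurable_const

theorem gradientError_le {p : Alloc d} {δ C : ℝ} {x : Alloc d} (hC : 0 ≤ C)
    (h : ∀ q ∈ Metric.ball p δ, ‖gradient (residual loss x) q - gradient (residual loss x) p -
      hess (residual loss x) p (q - p)‖ ≤ C * ‖q - p‖) :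
    gradientError loss p δ x ≤ ENNReal.ofReal C := by
  refine iSup_le fun k => ?_
  split_ifs with hk
  · exact ENNReal.ofReal_le_ofReal (div_le_of_le_mul₀ (norm_nonneg _) hC (h _ hk))
  · exact zero_le

theorem norm_le_gradientError {p : Alloc d} {δ : ℝ} {x : Alloc d}
    (hcont : ∀ q ∈ Metric.ball p δ, ContinuousAt (gradient (residual loss x)) q)
    (hfin : gradientError loss p δ x < ⊤) : ∀ q ∈ Metric.ball p δ,
    ‖gradient (residual loss x) q - gradient (residual loss x) p -
      hess (residual loss x) p (q - p)‖ ≤ (gradientError loss p δ x).toReal * ‖q - p‖ := by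
  have hc : ContinuousOn (gradient (residual loss x)) (Metric.ball p δ) :=
    fun q hq => (hcont q hq).continuousWithinAt
  refine forall_mem_le_of_dense Metric.isOpen_ball (TopologicalSpace.denseRange_denseSeq (Alloc d))
    ((hc.sub continuousOn_const).sub (by fun_prop)).norm (by fun_prop) ?_
  rintro _ ⟨hq, k, rfl⟩
  rcases eq_or_ne (TopologicalSpace.denseSeq (Alloc d) k) p with h | h
  · simp [h]
  · rw [← div_le_iff₀ (norm_pos_iff.2 (sub_ne_zero.2 h))]
    refine (ENNReal.ofReal_le_iff_le_toReal hfin.ne).1 ?_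
    refine le_trans ?_ (le_iSup _ k)
    rw [if_pos hq]

/-- The expected relative error tends to `0`, by dominated convergence: the error is at most
twice the bound on the Hessian, and tends to `0` because the gradient is differentiable at `p`. -/
theorem tendsto_lintegral_gradientError [IsFiniteMeasure μ] (hX : AEMeasurable X μ)
    (hdiff : ∀ m₀, ∀ᵐ ω ∂μ, GradDifferentiableAt (residual loss (X ω)) m₀)
    (hlip : GradLocallyLipschitz μ loss X M) (hD₂ : Integrable D₂ μ)
    (hdom : ∀ m ∈ M, ∀ᵐ ω ∂μ, ‖hess (residual loss (X ω)) m‖ ≤ D₂ ω) {p : Alloc d} {r : ℝ}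
    (hr : 0 < r) (hpr : Metric.ball p r ⊆ interior M) :
    (∀ n : ℕ, ∫⁻ ω, gradientError loss p (r / (n + 1)) (X ω) ∂μ < ⊤) ∧
      Tendsto (fun n : ℕ => ∫⁻ ω, gradientError loss p (r / (n + 1)) (X ω) ∂μ) atTop (𝓝 0) := by
  have hsub (n : ℕ) : Metric.ball p (r / (n + 1)) ⊆ Metric.ball p r :=
    Metric.ball_subset_ball (div_le_self hr.le (by simp))
  have hbound : ∀ᵐ ω ∂μ, ∀ n : ℕ,
      gradientError loss p (r / (n + 1)) (X ω) ≤ ENNReal.ofReal (2 * D₂ ω) := by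
    filter_upwards [ae_forall_norm_gradient_residual_sub_le hX hdiff hlip hD₂.aemeasurable hdom
      hr hpr, hdom p (interior_subset (hpr (Metric.mem_ball_self hr)))] with ω h1 h2 n
    have h0 : 0 ≤ D₂ ω := (norm_nonneg _).trans h2
    refine gradientError_le (by positivity) fun q hq => ?_
    calc _ ≤ D₂ ω * ‖q - p‖ + D₂ ω * ‖q - p‖ := by
          refine (norm_sub_le _ _).trans (add_le_add (h1 q (hsub n hq)) ?_)
          exact (ContinuousLinearMap.le_opNorm _ _).trans (by gcongr)
      _ = 2 * D₂ ω * ‖q - p‖ := by ring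
  have hfin : ∫⁻ ω, ENNReal.ofReal (2 * D₂ ω) ∂μ < ⊤ :=
    ((hD₂.const_mul 2).lintegral_lt_top)
  refine ⟨fun n => (lintegral_mono_ae (hbound.mono fun ω h => h n)).trans_lt hfin, ?_⟩
  have hlim : ∀ᵐ ω ∂μ,
      Tendsto (fun n : ℕ => gradientError loss p (r / (n + 1)) (X ω)) atTop (𝓝 0) := by
    filter_upwards [hdiff p] with ω hω
    rw [ENNReal.tendsto_nhds_zero]
    intro ε hε
    rcases eq_or_ne ε ⊤ with rfl | hε'
    · exact Eventually.of_forall fun n => le_top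
    have hε0 : 0 < ε.toReal := ENNReal.toReal_pos hε.ne' hε'
    have h1 := (hasFDerivAt_iff_isLittleO.1 hω.2.hasFDerivAt).bound hε0
    obtain ⟨δ, hδ, hball⟩ := Metric.eventually_nhds_iff_ball.1 h1
    have h2 : Tendsto (fun n : ℕ => r / ((n : ℝ) + 1)) atTop (𝓝 0) :=
      tendsto_const_nhds.div_atTop (tendsto_natCast_atTop_atTop.atTop_add tendsto_const_nhds)
    filter_upwards [h2.eventually_lt_const hδ] with n hn
    rw [← ENNReal.ofReal_toReal hε']
    exact gradientError_le hε0.le fun q hq => hball q (Metric.ball_subset_ball hn.le hq)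
  have key := tendsto_lintegral_of_dominated_convergence' (μ := μ)
    (fun ω => ENNReal.ofReal (2 * D₂ ω))
    (fun n => (measurable_gradientError p (r / (n + 1))).comp_aemeasurable hX)
    (fun n => hbound.mono fun ω h => h n) hfin.ne hlim
  simpa using key

end Sample

section SampleExpansion

variable {d : ℕ} {loss : Alloc d → EReal} {Ω : Type*} [MeasurableSpace Ω] {μ : Measure Ω}
  {X : Ω → Alloc d} {M : Set (Alloc d)} {D₂ : Ω → ℝ}

theorem hasGradientAt_sampleLoss {x : ℕ → Alloc d} {m : Alloc d} (N : ℕ)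
    (h : ∀ i, DifferentiableAt ℝ (residual loss (x i)) m) :
    HasGradientAt (sampleLoss loss x N)
      ((N : ℝ)⁻¹ • ∑ i ∈ Finset.range N, gradient (residual loss (x i)) m) m := by
  rw [hasGradientAt_iff_hasFDerivAt, map_smulₛₗ, map_sum]
  simp only [toDual_gradient]
  exact (HasFDerivAt.fun_sum (u := Finset.range N)
    fun i _ => (h i).hasFDerivAt).const_mul (N : ℝ)⁻¹

theorem ae_tendsto_gradient_sampleLoss [IsFiniteMeasure μ] (hloss : IsLossFunction loss)
    (hfin : ∀ x, loss x ≠ ⊤) (hX : InOrliczHeart μ loss X)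
    (hdiff : ∀ m₀, ∀ᵐ ω ∂μ, GradDifferentiableAt (residual loss (X ω)) m₀)
    (hlip : GradLocallyLipschitz μ loss X M) {Xs : ℕ → Ω → Alloc d} (hindep : iIndepFun Xs μ)
    (hident : ∀ i, IdentDistrib (Xs i) X μ μ) {p : Alloc d} (hp : p ∈ interior M) :
    ∀ᵐ ω ∂μ, Tendsto (fun N => gradient (sampleLoss loss (fun i => Xs i ω) N) p) atTop
      (𝓝 (gradient (expectedLoss μ loss X) p)) := by
  obtain ⟨h1, h2⟩ := hasGradientAt_expectedLoss (m := p) hloss hfin hX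
    ((hdiff p).mono fun ω h => h.1.self_of_nhds)
  rw [h2.gradient]
  filter_upwards [ae_tendsto_average hindep hident (measurable_gradient_residual p) h1,
    ae_all_iff.2 fun i => hlip.ae_identDistrib (hident i)] with ω hω hs
  refine hω.congr fun N => ?_
  rw [(hasGradientAt_sampleLoss N fun i => (hs i p hp).1).gradient]

/-- Almost surely the gradients of the sample functions admit at `p` an expansion to first order
that is uniform in the sample size, with the Hessian of the expected loss as linear part. -/
theorem ae_gradient_sampleLoss_expansion [IsFiniteMeasure μ] (hloss : IsLossFunction loss)
    (hfin : ∀ x, loss x ≠ ⊤) (hX : InOrliczHeart μ loss X)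
    (hdiff : ∀ m₀, ∀ᵐ ω ∂μ, GradDifferentiableAt (residual loss (X ω)) m₀)
    (hlip : GradLocallyLipschitz μ loss X M) (hD₂ : Integrable D₂ μ)
    (hdom : ∀ m ∈ M, ∀ᵐ ω ∂μ, ‖hess (residual loss (X ω)) m‖ ≤ D₂ ω)
    {Xs : ℕ → Ω → Alloc d} (hindep : iIndepFun Xs μ)
    (hident : ∀ i, IdentDistrib (Xs i) X μ μ) {p : Alloc d} (hp : p ∈ interior M) :
    ∀ᵐ ω ∂μ, ∀ ε > 0, ∃ δ > 0, ∀ᶠ N in atTop, ∀ q ∈ Metric.ball p δ,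
      ‖gradient (sampleLoss loss (fun i => Xs i ω) N) q -
        gradient (sampleLoss loss (fun i => Xs i ω) N) p -
        hess (expectedLoss μ loss X) p (q - p)‖ ≤ ε * ‖q - p‖ := by
  obtain ⟨r, hr, hpr⟩ := Metric.isOpen_iff.1 isOpen_interior p hp
  obtain ⟨hρfin, hρ0⟩ := tendsto_lintegral_gradientError hX.1 hdiff hlip hD₂ hdom hr hpr
  set ρ : ℕ → Alloc d → ENNReal := fun n => gradientError loss p (r / (n + 1)) with hρ
  have hρm (n : ℕ) : Measurable (ρ n) := measurable_gradientError p _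
  have hρlt (n : ℕ) : ∀ᵐ ω ∂μ, ρ n (X ω) < ⊤ :=
    ae_lt_top' ((hρm n).comp_aemeasurable hX.1) (hρfin n).ne
  have hρi (n : ℕ) : Integrable (fun ω => (ρ n (X ω)).toReal) μ :=
    integrable_toReal_of_lintegral_ne_top ((hρm n).comp_aemeasurable hX.1) (hρfin n).ne
  have hρr : Tendsto (fun n => ∫ ω, (ρ n (X ω)).toReal ∂μ) atTop (𝓝 0) := by
    have h1 := (ENNReal.tendsto_toReal ENNReal.zero_ne_top).comp hρ0
    refine h1.congr fun n => ?_
    exact (integral_toReal ((hρm n).comp_aemeasurable hX.1) (hρlt n)).symm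
  have hHi : Integrable (fun ω => hess (residual loss (X ω)) p) μ :=
    hD₂.mono' ((measurable_hess_residual p).comp_aemeasurable hX.1).aestronglyMeasurable
      (hdom p (interior_subset hp))
  have hH : hess (expectedLoss μ loss X) p = ∫ ω, hess (residual loss (X ω)) p ∂μ :=
    (hasFDerivAt_gradient_expectedLoss hloss hfin hX hdiff hlip hD₂ hdom hp).fderiv
  filter_upwards [ae_all_iff.2 fun i => hlip.ae_identDistrib (hident i),
    ae_all_iff.2 fun n => ae_tendsto_average hindep hident (hρm n).ennreal_toReal (hρi n),
    ae_tendsto_average hindep hident (measurable_hess_residual p) hHi,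
    ae_all_iff.2 fun i => ae_all_iff.2 fun n =>
      (hident i).symm.ae_mem_snd ((hρm n) measurableSet_Iio) (hρlt n)] with ω hs hav hhess hlt
  intro ε hε
  obtain ⟨n, hn⟩ := (hρr.eventually_lt_const (half_pos hε)).exists
  refine ⟨r / (n + 1), by positivity, ?_⟩
  rw [← hH, tendsto_iff_norm_sub_tendsto_zero] at hhess
  filter_upwards [(hav n).eventually_lt_const hn, hhess.eventually_lt_const (half_pos hε)]
    with N h1 h2 q hq
  have hqM : q ∈ interior M :=
    hpr (Metric.ball_subset_ball (div_le_self hr.le (by simp)) hq)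
  rw [(hasGradientAt_sampleLoss N fun i => (hs i q hqM).1).gradient,
    (hasGradientAt_sampleLoss N fun i => (hs i p hp).1).gradient]
  set R : ℕ → Alloc d := fun i => gradient (residual loss (Xs i ω)) q -
    gradient (residual loss (Xs i ω)) p - hess (residual loss (Xs i ω)) p (q - p) with hR
  have hRle (i : ℕ) : ‖R i‖ ≤ (ρ n (Xs i ω)).toReal * ‖q - p‖ :=
    norm_le_gradientError (fun q' hq' => (hs i q' (hpr (Metric.ball_subset_ball
      (div_le_self hr.le (by simp)) hq'))).2) (hlt i n) q hq
  have hsplit : (N : ℝ)⁻¹ • ∑ i ∈ Finset.range N, gradient (residual loss (Xs i ω)) q -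
      (N : ℝ)⁻¹ • ∑ i ∈ Finset.range N, gradient (residual loss (Xs i ω)) p -
      hess (expectedLoss μ loss X) p (q - p) =
      (N : ℝ)⁻¹ • ∑ i ∈ Finset.range N, R i +
        ((N : ℝ)⁻¹ • ∑ i ∈ Finset.range N, hess (residual loss (Xs i ω)) p -
          hess (expectedLoss μ loss X) p) (q - p) := by
    simp only [hR, Finset.sum_sub_distrib, smul_sub, sub_apply,
      smul_apply, sum_apply]
    abel
  rw [hsplit]
  calc _ ≤ ((N : ℝ)⁻¹ * ∑ i ∈ Finset.range N, (ρ n (Xs i ω)).toReal) * ‖q - p‖ +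
        ε / 2 * ‖q - p‖ := by
        refine (norm_add_le _ _).trans (add_le_add ?_ ?_)
        · rw [norm_smul, norm_inv, Real.norm_natCast, mul_assoc, Finset.sum_mul]
          gcongr
          exact (norm_sum_le _ _).trans (Finset.sum_le_sum fun i _ => hRle i)
        · exact (ContinuousLinearMap.le_opNorm _ _).trans (by gcongr)
    _ ≤ ε / 2 * ‖q - p‖ + ε / 2 * ‖q - p‖ := by
        gcongr
        exact h1.le
    _ = ε * ‖q - p‖ := by ring

end SampleExpansion

/-! ### Primal-dual vectors and the exact program -/

section Program

variable {d : ℕ}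

theorem inner_ones (v : Alloc d) :
    inner ℝ (WithLp.toLp 2 (fun _ => (1 : ℝ)) : Alloc d) v = ∑ k, v k := by
  simp [PiLp.inner_apply]

@[simp]
theorem primal_mkPD (v : Alloc d) (t : ℝ) : primal (mkPD v t) = v := by
  ext k
  simp [primal, mkPD]

@[simp]
theorem multiplier_mkPD (v : Alloc d) (t : ℝ) : multiplier (mkPD v t) = t := by
  simp [multiplier, mkPD]

theorem mkPD_eq_zero {v : Alloc d} {t : ℝ} : mkPD v t = 0 ↔ v = 0 ∧ t = 0 := by
  constructor
  · intro h
    have h1 := congrArg primal h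
    have h2 := congrArg multiplier h
    rw [primal_mkPD] at h1
    rw [multiplier_mkPD] at h2
    exact ⟨by rw [h1]; ext k; simp [primal], by rw [h2]; simp [multiplier]⟩
  · rintro ⟨rfl, rfl⟩
    ext (k | k) <;> simp [mkPD]

theorem norm_sq_eq_primal_add_multiplier (z : PrimalDual d) :
    ‖z‖ ^ 2 = ‖primal z‖ ^ 2 + multiplier z ^ 2 := by
  simp [EuclideanSpace.norm_sq_eq, primal, multiplier]

theorem norm_primal_le (z : PrimalDual d) : ‖primal z‖ ≤ ‖z‖ := by
  refine (abs_le_of_sq_le_sq' ?_ (norm_nonneg z)).2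
  rw [norm_sq_eq_primal_add_multiplier]
  nlinarith [sq_nonneg (multiplier z)]

theorem abs_multiplier_le (z : PrimalDual d) : |multiplier z| ≤ ‖z‖ := by
  refine abs_le_of_sq_le_sq ?_ (norm_nonneg z)
  rw [norm_sq_eq_primal_add_multiplier]
  nlinarith [sq_nonneg ‖primal z‖]

theorem norm_le_primal_add_multiplier (z : PrimalDual d) :
    ‖z‖ ≤ ‖primal z‖ + |multiplier z| := by
  refine (abs_le_of_sq_le_sq' ?_ (by positivity)).2
  rw [norm_sq_eq_primal_add_multiplier]
  nlinarith [norm_nonneg (primal z), abs_nonneg (multiplier z), sq_abs (multiplier z)]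

theorem IsPrimalDualSolution.apply_eq_zero {g : Alloc d → ℝ} {z : PrimalDual d}
    (hz : IsPrimalDualSolution g z) : g (primal z) = 0 :=
  (mkPD_eq_zero.1 hz.stationary).2

theorem IsPrimalDualSolution.gradient_eq {g : Alloc d → ℝ} {z : PrimalDual d}
    (hz : IsPrimalDualSolution g z) :
    gradient g (primal z) = -(multiplier z)⁻¹ • WithLp.toLp 2 (fun _ => (1 : ℝ)) := by
  have h := (mkPD_eq_zero.1 hz.stationary).1
  have h0 := hz.multiplier_pos.ne'
  rw [neg_smul, eq_neg_of_add_eq_zero_left h, smul_neg, smul_smul, inv_mul_cancel₀ h0, one_smul,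
    neg_neg]

/-- By convexity and the second-order condition, the exact program has no second solution. If `m`
were one, `g` would be nonpositive on the segment from `primal z` to `m`. But at `primal z` it
starts to increase along this segment, to first order if `∑ k, m k < ∑ k, primal z k`, and to
second order otherwise. -/
theorem IsPrimalDualSolution.eq_of_sum_le {g : Alloc d → ℝ} {z : PrimalDual d}
    (hz : IsPrimalDualSolution g z) (hg : ConvexOn ℝ Set.univ g)
    (hgd : ∀ᶠ m in 𝓝 (primal z), DifferentiableAt ℝ g m)
    (hgg : DifferentiableAt ℝ (gradient g) (primal z)) (hss : SSOSC g (primal z)) {m : Alloc d}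
    (hm : g m ≤ 0) (hsum : ∑ k, m k ≤ ∑ k, primal z k) : m = primal z := by
  by_contra hne
  set p := primal z with hp
  set a := m - p with ha
  have ha0 : a ≠ 0 := sub_ne_zero.2 hne
  set γ : ℝ → Alloc d := fun t => p + t • a with hγ
  have hγ0 : γ 0 = p := by simp [hγ]
  have hγd (t : ℝ) : HasDerivAt γ a t := by
    simpa only [one_smul] using ((hasDerivAt_id' t).smul_const a).const_add p
  have hγt : Tendsto γ (𝓝 0) (𝓝 p) := by
    have := (hγd 0).continuousAt.tendsto
    rwa [hγ0] at this
  have hnonpos : ∀ t ∈ Set.Icc (0 : ℝ) 1, g (γ t) ≤ 0 := by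
    intro t ht
    have h1 := hg.2 (Set.mem_univ p) (Set.mem_univ m) (sub_nonneg.2 ht.2) ht.1
      (sub_add_cancel 1 t)
    rw [show (1 - t) • p + t • m = γ t by simp only [hγ, ha]; module] at h1
    rw [hz.apply_eq_zero, smul_zero, zero_add, smul_eq_mul] at h1
    exact h1.trans (mul_nonpos_of_nonneg_of_nonpos ht.1 hm)
  set φ' : ℝ → ℝ := fun t => inner ℝ (gradient g (γ t)) a with hφ'
  have hdφ : ∀ᶠ t in 𝓝 (0 : ℝ), HasDerivAt (fun t => g (γ t)) (φ' t) t := by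
    filter_upwards [hγt.eventually hgd] with t ht
    simp only [hφ', inner_gradient]
    exact ht.hasFDerivAt.comp_hasDerivAt t (hγd t)
  have hφ'0 : φ' 0 = -(multiplier z)⁻¹ * ∑ k, a k := by
    simp only [hφ', hγ0]
    rw [hp, hz.gradient_eq, real_inner_smul_left, inner_ones]
  have hφ'd : HasDerivAt φ' (inner ℝ a (hess g p a)) 0 := by
    have h1 : HasFDerivAt (gradient g) (hess g p) (γ 0) := by
      rw [hγ0]
      exact hgg.hasFDerivAt
    have h2 := (innerSL ℝ a).hasFDerivAt.comp_hasDerivAt 0 (h1.comp_hasDerivAt 0 (hγd 0))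
    refine h2.congr_of_eventuallyEq (Eventually.of_forall fun t => ?_)
    simp [hφ', real_inner_comm]
  have hpos : ∀ᶠ t in 𝓝[>] (0 : ℝ), 0 < φ' t := by
    have hsa : ∑ k, a k ≤ 0 := by
      simp only [ha, PiLp.sub_apply, Finset.sum_sub_distrib]
      linarith
    have hinv := inv_pos.2 hz.multiplier_pos
    rcases hsa.lt_or_eq with h | h
    · have h1 : 0 < φ' 0 := by rw [hφ'0]; nlinarith
      exact (hφ'd.continuousAt.eventually_const_lt h1).filter_mono nhdsWithin_le_nhds
    · have h1 : φ' 0 = 0 := by rw [hφ'0, h, mul_zero]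
      have h2 : inner ℝ (gradient g p) a = 0 := by rw [← h1, hφ']; simp [hγ0]
      have h3 := hasDerivAt_iff_tendsto_slope.1 hφ'd
      have h4 := (h3.eventually_const_lt (hss a ha0 h2)).filter_mono
        (nhdsWithin_mono _ fun t (ht : 0 < t) => ht.ne')
      filter_upwards [h4, self_mem_nhdsWithin] with t ht (ht0 : 0 < t)
      rw [slope_def_field, h1, sub_zero, sub_zero] at ht
      exact (div_pos_iff_of_pos_right ht0).1 ht
  obtain ⟨ε, hε, hball⟩ := Metric.eventually_nhds_iff_ball.1 hdφ
  obtain ⟨u, hu, hposu⟩ := mem_nhdsGT_iff_exists_Ioo_subset.1 hpos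
  set s := min (min (ε / 2) u) 1 with hs
  have hs0 : 0 < s := lt_min (lt_min (half_pos hε) hu) one_pos
  have hsε : s < ε := ((min_le_left _ _).trans (min_le_left _ _)).trans_lt (half_lt_self hε)
  have hd : ∀ t ∈ Set.Icc 0 s, HasDerivAt (fun t => g (γ t)) (φ' t) t := fun t ht =>
    hball t (by rw [Metric.mem_ball, Real.dist_eq, sub_zero, abs_of_nonneg ht.1]; linarith [ht.2])
  have hmono : StrictMonoOn (fun t => g (γ t)) (Set.Icc 0 s) := by
    refine strictMonoOn_of_deriv_pos (convex_Icc 0 s)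
      (fun t ht => (hd t ht).continuousAt.continuousWithinAt) fun t ht => ?_
    rw [interior_Icc] at ht
    rw [(hd t (Set.Ioo_subset_Icc_self ht)).deriv]
    exact hposu ⟨ht.1, ht.2.trans_le ((min_le_left _ _).trans (min_le_right _ _))⟩
  have h1 := hmono (Set.left_mem_Icc.2 hs0.le) (Set.right_mem_Icc.2 hs0.le) hs0
  simp only [hγ0] at h1
  rw [hz.apply_eq_zero] at h1
  exact h1.not_ge (hnonpos s ⟨hs0.le, min_le_right _ _⟩)

end Program

/-! ### Programs with approximating constraint functions -/

section Approximation

variable {d : ℕ}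

/-- The functions `f N` approximate `g` uniformly on `M`, are continuously differentiable in its
interior, and their gradients approximate that of `g` to first order at `p`. -/
structure Approximates (f : ℕ → Alloc d → ℝ) (g : Alloc d → ℝ) (M : Set (Alloc d))
    (p : Alloc d) : Prop where
  continuous : ∀ N, Continuous (f N)
  unif : TendstoUniformlyOn f g atTop M
  smooth : ∀ N, ∀ m ∈ interior M, DifferentiableAt ℝ (f N) m ∧ ContinuousAt (gradient (f N)) m
  grad : Tendsto (fun N => gradient (f N) p) atTop (𝓝 (gradient g p))
  expansion : ∀ ε > 0, ∃ δ > 0, ∀ᶠ N in atTop, ∀ q ∈ Metric.ball p δ,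
    ‖gradient (f N) q - gradient (f N) p - hess g p (q - p)‖ ≤ ε * ‖q - p‖

/-- `m` minimizes `∑ k, m k` over the `m ∈ M` with `f m ≤ 0`. -/
def IsProgramMin (f : Alloc d → ℝ) (M : Set (Alloc d)) (m : Alloc d) : Prop :=
  m ∈ M ∧ f m ≤ 0 ∧ ∀ m' ∈ M, f m' ≤ 0 → ∑ k, m k ≤ ∑ k, m' k

variable {f : ℕ → Alloc d → ℝ} {g : Alloc d → ℝ} {M : Set (Alloc d)} {z : PrimalDual d}

theorem Approximates.eventually_norm_gradient_sub_le {p : Alloc d} (h : Approximates f g M p)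
    {ε : ℝ} (hε : 0 < ε) : ∃ δ > 0, ∀ᶠ N in atTop, ∀ q ∈ Metric.ball p δ,
      ‖gradient (f N) q - gradient g p‖ ≤ ε := by
  obtain ⟨δ, hδ, hexp⟩ := h.expansion 1 one_pos
  have hgrad := tendsto_iff_norm_sub_tendsto_zero.1 h.grad
  have hH : 0 < 1 + ‖hess g p‖ := by positivity
  refine ⟨min δ (ε / 2 / (1 + ‖hess g p‖)), by positivity, ?_⟩
  filter_upwards [hexp, hgrad.eventually_lt_const (half_pos hε)] with N h1 h2 q hq
  have h3 := h1 q (Metric.ball_subset_ball (min_le_left _ _) hq)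
  have h4 : ‖q - p‖ * (1 + ‖hess g p‖) ≤ ε / 2 := by
    rw [← le_div_iff₀ hH, ← dist_eq_norm]
    exact (Metric.mem_ball.1 hq).le.trans (min_le_right _ _)
  have h5 := (hess g p).le_opNorm (q - p)
  calc ‖gradient (f N) q - gradient g p‖
      = ‖(gradient (f N) q - gradient (f N) p - hess g p (q - p)) + hess g p (q - p) +
          (gradient (f N) p - gradient g p)‖ := by congr 1; abel
    _ ≤ 1 * ‖q - p‖ + ‖hess g p‖ * ‖q - p‖ + ε / 2 :=
        norm_add₃_le.trans (add_le_add_three h3 h5 h2.le)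
    _ ≤ ε := by linarith

/-- Slater points: moving from the exact solution in the direction `(1, …, 1)` makes the
constraint inactive at an arbitrarily small cost. -/
theorem IsPrimalDualSolution.exists_slater [Nonempty (Fin d)] (hz : IsPrimalDualSolution g z)
    (hgd : DifferentiableAt ℝ g (primal z)) (hzM : primal z ∈ interior M) {η : ℝ} (hη : 0 < η) :
    ∃ m ∈ M, g m < 0 ∧ ∑ k, m k < ∑ k, primal z k + η := by
  set e : Alloc d := WithLp.toLp 2 (fun _ => (1 : ℝ)) with he
  have hcard : (0 : ℝ) < d := by exact_mod_cast Fin.pos_iff_nonempty.2 ‹_›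
  have hγ : HasDerivAt (fun t : ℝ => primal z + t • e) e 0 := by
    simpa only [one_smul] using ((hasDerivAt_id' (0 : ℝ)).smul_const e).const_add (primal z)
  have hγ0 : primal z + (0 : ℝ) • e = primal z := by simp
  have hφ : HasDerivAt (fun t : ℝ => g (primal z + t • e)) (-(multiplier z)⁻¹ * d) 0 := by
    have h1 : HasFDerivAt g (fderiv ℝ g (primal z)) (primal z + (0 : ℝ) • e) := by
      rw [hγ0]
      exact hgd.hasFDerivAt
    convert! h1.comp_hasDerivAt 0 hγ using 1
    rw [← inner_gradient, hz.gradient_eq, real_inner_smul_left, inner_ones]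
    simp [he]
  have hneg : -(multiplier z)⁻¹ * d < 0 := by
    have := inv_pos.2 hz.multiplier_pos
    nlinarith
  have h2 := ((hasDerivAt_iff_tendsto_slope.1 hφ).eventually_lt_const hneg).filter_mono
    (nhdsWithin_mono (0 : ℝ) fun t (ht : t ∈ Set.Ioi 0) => ne_of_gt ht)
  have h3 : ∀ᶠ t in 𝓝[>] (0 : ℝ), primal z + t • e ∈ M := by
    have h4 : ∀ᶠ m in 𝓝 (primal z + (0 : ℝ) • e), m ∈ M := by
      rw [hγ0]
      exact mem_interior_iff_mem_nhds.1 hzM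
    exact (hγ.continuousAt.eventually h4).filter_mono nhdsWithin_le_nhds
  have h5 : ∀ᶠ t in 𝓝[>] (0 : ℝ), t < η / d :=
    (eventually_lt_nhds (by positivity)).filter_mono nhdsWithin_le_nhds
  have h0 : ∀ᶠ t in 𝓝[>] (0 : ℝ), 0 < t := self_mem_nhdsWithin
  obtain ⟨t, ht0, ht2, ht3, ht5⟩ := (h0.and (h2.and (h3.and h5))).exists
  refine ⟨_, ht3, ?_, ?_⟩
  · rw [slope_def_field, hγ0, hz.apply_eq_zero, sub_zero, sub_zero] at ht2
    by_contra hcon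
    exact ht2.not_ge (div_nonneg (not_lt.1 hcon) ht0.le)
  · rw [lt_div_iff₀ hcard] at ht5
    simp only [PiLp.add_apply, PiLp.smul_apply, he, smul_eq_mul, mul_one, Finset.sum_add_distrib,
      Finset.sum_const, Finset.card_univ, Fintype.card_fin, nsmul_eq_mul]
    linarith

/-- Solutions of the approximating programs concentrate at the exact solution: away from it,
`max (∑ k, m k - ∑ k, primal z k) (g m)` is bounded below on `M` by a positive constant. -/
theorem Approximates.eventually_dist_lt [Nonempty (Fin d)] (h : Approximates f g M (primal z))
    (hM : IsCompact M) (hz : IsPrimalDualSolution g z) (hzM : primal z ∈ interior M)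
    (hgd : DifferentiableAt ℝ g (primal z)) (hgc : ContinuousOn g M)
    (huniq : ∀ m, g m ≤ 0 → ∑ k, m k ≤ ∑ k, primal z k → m = primal z) {δ : ℝ} (hδ : 0 < δ) :
    ∀ᶠ N in atTop, ∀ m, IsProgramMin (f N) M m → dist m (primal z) < δ := by
  set F : Alloc d → ℝ := fun m => max (∑ k, m k - ∑ k, primal z k) (g m) with hF
  have hK : IsCompact (M \ Metric.ball (primal z) δ) := hM.diff Metric.isOpen_ball
  obtain ⟨η, hη, hFη⟩ : ∃ η > 0, ∀ m ∈ M \ Metric.ball (primal z) δ, η ≤ F m := by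
    rcases (M \ Metric.ball (primal z) δ).eq_empty_or_nonempty with h0 | h0
    · exact ⟨1, one_pos, by simp [h0]⟩
    · have hFc : ContinuousOn F (M \ Metric.ball (primal z) δ) :=
        ContinuousOn.sup (by fun_prop) (hgc.mono Set.sdiff_subset)
      obtain ⟨m₀, hm₀, hmin⟩ := hK.exists_isMinOn h0 hFc
      refine ⟨F m₀, ?_, fun m hm => hmin hm⟩
      by_contra hcon
      have h1 := max_le_iff.1 (not_lt.1 hcon)
      have h2 := huniq m₀ h1.2 (by linarith [h1.1])
      exact hm₀.2 (by rw [h2]; exact Metric.mem_ball_self hδ)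
  obtain ⟨s, hsM, hgs, hsum⟩ := hz.exists_slater hgd hzM hη
  filter_upwards [Metric.tendstoUniformlyOn_iff.1 h.unif _ (lt_min hη (neg_pos.2 hgs))]
    with N hN m ⟨hmM, hfm, hmin⟩
  have h1 := hN s hsM
  have h2 := hN m hmM
  rw [Real.dist_eq] at h1 h2
  have h3 := (abs_lt.1 h1).1
  have h4 := (abs_lt.1 h2).2
  have h5 : f N s ≤ 0 := by linarith [min_le_right η (-g s)]
  have h6 := hmin s hsM h5
  by_contra hcon
  refine (hFη m ⟨hmM, fun hb => hcon (Metric.mem_ball.1 hb)⟩).not_gt (max_lt ?_ ?_)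
  · linarith
  · linarith [min_le_left η (-g s)]

/-- A solution in the interior satisfies the first-order conditions with a multiplier close to the
exact one, provided that the gradient of the constraint is close to the exact gradient there. -/
theorem IsProgramMin.exists_multiplier [Nonempty (Fin d)] {f : Alloc d → ℝ} {m : Alloc d}
    (hm : IsProgramMin f M m) (hmM : m ∈ interior M)
    (hsm : ∀ m ∈ interior M, DifferentiableAt ℝ f m ∧ ContinuousAt (gradient f) m)
    {lam lamBar : ℝ} (hlam : 0 < lam) (hlamBar : lam < lamBar)
    (hclose : ‖gradient f m - -lam⁻¹ • WithLp.toLp 2 (fun _ => (1 : ℝ))‖ ≤ lam⁻¹ - lamBar⁻¹) :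
    ∃ t ∈ Set.Ioc 0 lamBar, lagrangianGradient f (mkPD m t) = 0 := by
  set e : Alloc d := WithLp.toLp 2 (fun _ => (1 : ℝ)) with he
  obtain ⟨k₀⟩ := ‹Nonempty (Fin d)›
  have hk₀ : gradient f m k₀ ≤ -lamBar⁻¹ := by
    have h1 := (PiLp.norm_apply_le (gradient f m - -lam⁻¹ • e) k₀).trans hclose
    simp only [PiLp.sub_apply, PiLp.smul_apply, he, smul_eq_mul, mul_one, Real.norm_eq_abs] at h1
    linarith [(abs_le.1 h1).2]
  have hbar : 0 < lamBar⁻¹ := inv_pos.2 (hlam.trans hlamBar)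
  -- The constraint is active, since otherwise one could move in the direction `-e`.
  have hact : f m = 0 := by
    refine le_antisymm hm.2.1 (not_lt.1 fun hneg => ?_)
    have hγ : Tendsto (fun t : ℝ => m - t • e) (𝓝[>] 0) (𝓝 m) := by
      have : Continuous fun t : ℝ => m - t • e := by fun_prop
      simpa using (this.tendsto 0).mono_left nhdsWithin_le_nhds
    have h1 := hγ.eventually ((hsm m hmM).1.continuousAt.eventually_lt_const hneg)
    have h2 := hγ.eventually (mem_interior_iff_mem_nhds.1 hmM)
    obtain ⟨t, ht1, ht2, ht0⟩ := (h1.and (h2.and self_mem_nhdsWithin)).exists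
    have h3 := hm.2.2 _ ht2 ht1.le
    simp only [PiLp.sub_apply, PiLp.smul_apply, he, smul_eq_mul, mul_one, Finset.sum_sub_distrib,
      Finset.sum_const, Finset.card_univ, Fintype.card_fin, nsmul_eq_mul] at h3
    have hcard : (0 : ℝ) < d := by exact_mod_cast Fin.pos_iff_nonempty.2 ⟨k₀⟩
    have h4 : 0 < d * t := mul_pos hcard ht0
    linarith
  have hstrict : HasStrictFDerivAt f (fderiv ℝ f m) m := by
    refine hasStrictFDerivAt_of_hasFDerivAt_of_continuousAt ?_ ?_
    · filter_upwards [isOpen_interior.mem_nhds hmM] with m' hm'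
      exact (hsm m' hm').1.hasFDerivAt
    · rw [← toDual_comp_gradient]
      exact (InnerProductSpace.toDual ℝ (Alloc d)).continuous.continuousAt.comp (hsm m hmM).2
  have hextr : IsLocalExtrOn (innerSL ℝ e) {m' | f m' = f m} m := by
    refine Or.inl ?_
    filter_upwards [mem_nhdsWithin_of_mem_nhds (mem_interior_iff_mem_nhds.1 hmM),
      self_mem_nhdsWithin] with m' h1 h2
    simp only [innerSL_apply_apply, he, inner_ones]
    exact hm.2.2 m' h1 (by rw [show f m' = f m from h2, hact])
  obtain ⟨a, b, hab, hsum⟩ := hextr.exists_multipliers_of_hasStrictFDerivAt_1d hstrict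
    (innerSL ℝ e).hasStrictFDerivAt
  have hgrad : a • gradient f m + b • e = 0 := by
    refine ext_inner_right ℝ fun v => ?_
    have := congrArg (fun l : Alloc d →L[ℝ] ℝ => l v) hsum
    simpa [inner_add_left, real_inner_smul_left, inner_gradient] using this
  have hcoord : a * gradient f m k₀ + b = 0 := by
    simpa [he] using congrArg (fun v : Alloc d => v k₀) hgrad
  have hb : b ≠ 0 := by
    rintro rfl
    rw [add_zero] at hcoord
    rcases mul_eq_zero.1 hcoord with h | h
    · exact hab (by rw [h]; rfl)
    · linarith
  have ht : a / b * gradient f m k₀ = -1 := by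
    field_simp
    linarith
  have hgeq : e + (a / b) • gradient f m = 0 := by
    have := congrArg (fun v => b⁻¹ • v) hgrad
    simpa [smul_smul, hb, add_comm, div_eq_inv_mul] using this
  have ht0 : 0 < a / b := by
    by_contra hcon
    nlinarith [not_lt.1 hcon]
  refine ⟨a / b, ⟨ht0, ?_⟩, mkPD_eq_zero.2 ⟨?_, ?_⟩⟩
  · have : a / b * lamBar⁻¹ ≤ 1 := by nlinarith
    rwa [← div_eq_mul_inv, div_le_one (hlam.trans hlamBar)] at this
  · simpa using hgeq
  · simpa using hact

end Approximation

section Asymptotics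

variable {d : ℕ} {f : ℕ → Alloc d → ℝ} {g : Alloc d → ℝ} {M : Set (Alloc d)} {z : PrimalDual d}

/-- For large `N` the program has a solution with a multiplier. -/
theorem Approximates.eventually_exists_solution [Nonempty (Fin d)]
    (h : Approximates f g M (primal z))
    (hM : IsCompact M) (hz : IsPrimalDualSolution g z) (hzM : primal z ∈ interior M)
    (hgd : DifferentiableAt ℝ g (primal z)) (hgc : ContinuousOn g M)
    (huniq : ∀ m, g m ≤ 0 → ∑ k, m k ≤ ∑ k, primal z k → m = primal z) {lamBar : ℝ}
    (hlam : multiplier z < lamBar) :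
    ∀ᶠ N in atTop, ∃ z', IsProgramMin (f N) M (primal z') ∧ primal z' ∈ interior M ∧
      multiplier z' ∈ Set.Ioc 0 lamBar ∧ lagrangianGradient (f N) z' = 0 := by
  have hε : 0 < (multiplier z)⁻¹ - lamBar⁻¹ :=
    sub_pos.2 (inv_strictAnti₀ hz.multiplier_pos hlam)
  obtain ⟨δ₁, hδ₁, hgrad⟩ := h.eventually_norm_gradient_sub_le hε
  obtain ⟨δ₂, hδ₂, hball⟩ := Metric.isOpen_iff.1 isOpen_interior _ hzM
  obtain ⟨s, hsM, hgs, -⟩ := hz.exists_slater hgd hzM one_pos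
  filter_upwards [hgrad, h.eventually_dist_lt hM hz hzM hgd hgc huniq (lt_min hδ₁ hδ₂),
    (h.unif.tendsto_at hsM).eventually_lt_const hgs] with N h1 h2 h3
  have hcomp : IsCompact (M ∩ {m | f N m ≤ 0}) :=
    hM.inter_right (isClosed_le (h.continuous N) continuous_const)
  obtain ⟨m, hm, hmin⟩ := hcomp.exists_isMinOn ⟨s, hsM, h3.le⟩
    (f := fun m : Alloc d => ∑ k, m k) (by fun_prop)
  have hmP : IsProgramMin (f N) M m := ⟨hm.1, hm.2, fun m' h4 h5 => hmin ⟨h4, h5⟩⟩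
  have hdist := h2 m hmP
  have hcl := h1 m (hdist.trans_le (min_le_left _ _))
  rw [hz.gradient_eq] at hcl
  have hmM : m ∈ interior M := hball (hdist.trans_le (min_le_right _ _))
  obtain ⟨t, ht, hst⟩ := hmP.exists_multiplier hmM (h.smooth N) hz.multiplier_pos hlam hcl
  exact ⟨mkPD m t, by simpa using hmP, by simpa using hmM, by simpa using ht, hst⟩

/-- Solutions of the approximating programs and their multipliers converge to the exact ones. -/
theorem Approximates.tendsto_solution [Nonempty (Fin d)] (h : Approximates f g M (primal z))
    (hM : IsCompact M) (hz : IsPrimalDualSolution g z) (hzM : primal z ∈ interior M)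
    (hgd : DifferentiableAt ℝ g (primal z)) (hgc : ContinuousOn g M)
    (huniq : ∀ m, g m ≤ 0 → ∑ k, m k ≤ ∑ k, primal z k → m = primal z) {zs : ℕ → PrimalDual d}
    (hzs : ∀ᶠ N in atTop, IsProgramMin (f N) M (primal (zs N)))
    (hstat : ∀ᶠ N in atTop, primal (zs N) ∈ interior M → lagrangianGradient (f N) (zs N) = 0) :
    Tendsto zs atTop (𝓝 z) := by
  have hprim : Tendsto (fun N => primal (zs N)) atTop (𝓝 (primal z)) := by
    rw [Metric.tendsto_nhds]
    intro δ hδ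
    filter_upwards [hzs, h.eventually_dist_lt hM hz hzM hgd hgc huniq hδ] with N h1 h2
    exact h2 _ h1
  have hstat' : ∀ᶠ N in atTop, lagrangianGradient (f N) (zs N) = 0 := by
    filter_upwards [hstat, hprim.eventually (isOpen_interior.mem_nhds hzM)] with N h1 h2
    exact h1 h2
  have hgr : Tendsto (fun N => gradient (f N) (primal (zs N))) atTop
      (𝓝 (gradient g (primal z))) := by
    rw [tendsto_iff_norm_sub_tendsto_zero, Metric.tendsto_nhds]
    intro ε hε
    obtain ⟨δ, hδ, hcl⟩ := h.eventually_norm_gradient_sub_le (half_pos hε)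
    filter_upwards [hcl, hprim.eventually (Metric.ball_mem_nhds _ hδ)] with N h1 h2
    rw [Real.dist_eq, sub_zero, abs_norm]
    exact (h1 _ h2).trans_lt (half_lt_self hε)
  obtain ⟨k₀⟩ := ‹Nonempty (Fin d)›
  have hlim : Tendsto (fun N => -(gradient (f N) (primal (zs N)) k₀)) atTop
      (𝓝 (multiplier z)⁻¹) := by
    have h1 := (((EuclideanSpace.proj (𝕜 := ℝ) k₀ : Alloc d →L[ℝ] ℝ).continuous.tendsto
      (gradient g (primal z))).comp hgr).neg
    rw [hz.gradient_eq] at h1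
    simpa [Function.comp_def] using h1
  have hmul : Tendsto (fun N => multiplier (zs N)) atTop (𝓝 (multiplier z)) := by
    have h1 := hlim.inv₀ (inv_ne_zero hz.multiplier_pos.ne')
    rw [inv_inv] at h1
    refine h1.congr' ?_
    filter_upwards [hstat'] with N h2
    have h3 := congrArg (fun v : Alloc d => v k₀) (mkPD_eq_zero.1 h2).1
    simp only [PiLp.add_apply, PiLp.smul_apply, smul_eq_mul, PiLp.zero_apply] at h3
    refine inv_eq_of_mul_eq_one_left ?_
    linarith
  rw [tendsto_iff_norm_sub_tendsto_zero] at hprim hmul ⊢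
  refine squeeze_zero (fun _ => norm_nonneg _) (fun N => ?_) (by simpa using hprim.add hmul)
  exact norm_le_primal_add_multiplier (zs N - z)

theorem toEuclideanCLM_lagrangianHessian (g : Alloc d → ℝ) (z v : PrimalDual d) :
    Matrix.toEuclideanCLM (𝕜 := ℝ) (lagrangianHessian g z) v =
      mkPD (multiplier z • hess g (primal z) (primal v) + multiplier v • gradient g (primal z))
        (inner ℝ (gradient g (primal z)) (primal v)) := by
  have hsum (u : Alloc d) (i : Fin d) : hess g (primal z) u i =
      ∑ j, hess g (primal z) (EuclideanSpace.single j 1) i * u j := by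
    have h1 : u = ∑ j, u j • EuclideanSpace.single j (1 : ℝ) := by
      simpa using ((EuclideanSpace.basisFun (Fin d) ℝ).sum_repr u).symm
    conv_lhs => rw [h1]
    simp [mul_comm]
  have hv (j : Fin d) : v (Sum.inl j) = primal v j := rfl
  have hv' : v (Sum.inr ()) = multiplier v := rfl
  ext (i | i)
  · change _ = multiplier z * hess g (primal z) (primal v) i +
      multiplier v * gradient g (primal z) i
    rw [hsum]
    simp [lagrangianHessian, Matrix.ofLp_toEuclideanCLM, Matrix.mulVec, dotProduct,
      hessMatrix, hv, hv', Finset.mul_sum, mul_assoc, mul_comm (multiplier v)]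
  · rw [PiLp.inner_apply]
    simp [lagrangianHessian, Matrix.ofLp_toEuclideanCLM, Matrix.mulVec, dotProduct, mkPD,
      hv, mul_comm]

/-- The gradient of the approximating Lagrangian vanishes at `zs N`, so its value at the exact
solution `z` is, to first order, the exact Hessian of the Lagrangian applied to `z - zs N`. -/
theorem Approximates.isLittleO_lagrangianGradient (h : Approximates f g M (primal z))
    (hzM : primal z ∈ interior M) {zs : ℕ → PrimalDual d}
    (hlim : Tendsto zs atTop (𝓝 z))
    (hstat : ∀ᶠ N in atTop, primal (zs N) ∈ interior M → lagrangianGradient (f N) (zs N) = 0) :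
    (fun N => lagrangianGradient (f N) z +
      Matrix.toEuclideanCLM (𝕜 := ℝ) (lagrangianHessian g z) (zs N - z)) =o[atTop]
      fun N => zs N - z := by
  set p := primal z with hp
  have hprim : Tendsto (fun N => primal (zs N)) atTop (𝓝 p) := by
    rw [tendsto_iff_norm_sub_tendsto_zero] at hlim ⊢
    exact squeeze_zero (fun _ => norm_nonneg _) (fun N => norm_primal_le (zs N - z)) hlim
  refine Asymptotics.IsLittleO.of_bound fun c hc => ?_
  have hC : 0 < |multiplier z| + 2 := by positivity
  set ε := c / (|multiplier z| + 2) with hε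
  have hε0 : 0 < ε := by positivity
  obtain ⟨δ₁, hδ₁, h1⟩ := h.eventually_norm_gradient_sub_le hε0
  obtain ⟨δ₂, hδ₂, h2⟩ := h.expansion ε hε0
  obtain ⟨δ₃, hδ₃, hball⟩ := Metric.isOpen_iff.1 isOpen_interior _ hzM
  filter_upwards [h1, h2, hstat,
    hprim.eventually (Metric.ball_mem_nhds p (lt_min (lt_min hδ₁ hδ₂) hδ₃))]
    with N h1 h2 h3 hq
  set q := primal (zs N) with hqdef
  have hq1 : q ∈ Metric.ball p δ₁ := Metric.ball_subset_ball
    ((min_le_left _ _).trans (min_le_left _ _)) hq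
  have hq2 : q ∈ Metric.ball p δ₂ := Metric.ball_subset_ball
    ((min_le_left _ _).trans (min_le_right _ _)) hq
  have hqM : q ∈ interior M := hball (Metric.ball_subset_ball (min_le_right _ _) hq)
  have hmv : ‖f N q - f N p - inner ℝ (gradient g p) (q - p)‖ ≤ ε * ‖q - p‖ := by
    refine Convex.norm_image_sub_le_of_norm_fderiv_le' (𝕜 := ℝ)
      (s := Metric.ball p (min δ₁ δ₃)) (φ := InnerProductSpace.toDual ℝ (Alloc d) (gradient g p))
      (fun m hm => (h.smooth N m
        (hball (Metric.ball_subset_ball (min_le_right _ _) hm))).1) (fun m hm => ?_)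
      (convex_ball _ _) (Metric.mem_ball_self (lt_min hδ₁ hδ₃)) ?_
    · rw [← toDual_gradient, ← map_sub, LinearIsometryEquiv.norm_map]
      exact h1 m (Metric.ball_subset_ball (min_le_left _ _) hm)
    · exact Metric.ball_subset_ball (min_le_min_right _ (min_le_left _ _)) hq
  obtain ⟨hs1, hs2⟩ := mkPD_eq_zero.1 (h3 hqM)
  set τ := multiplier (zs N) - multiplier z with hτ
  have hsub : primal (zs N - z) = q - p := rfl
  have hsub' : multiplier (zs N - z) = τ := rfl
  have hsplit : lagrangianGradient (f N) z +
      Matrix.toEuclideanCLM (𝕜 := ℝ) (lagrangianHessian g z) (zs N - z) =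
      mkPD (-(multiplier z • (gradient (f N) q - gradient (f N) p - hess g p (q - p))) -
        τ • (gradient (f N) q - gradient g p))
        (-(f N q - f N p - inner ℝ (gradient g p) (q - p))) := by
    rw [toEuclideanCLM_lagrangianHessian, hsub, hsub', lagrangianGradient, ← hp]
    have hadd (v v' : Alloc d) (t t' : ℝ) : mkPD v t + mkPD v' t' = mkPD (v + v') (t + t') := by
      ext (k | k) <;> simp [mkPD]
    rw [hadd]
    congr 1
    · rw [← sub_eq_zero, ← hs1, hτ]
      module
    · rw [hs2]
      ring
  rw [hsplit]
  refine (norm_le_primal_add_multiplier _).trans ?_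
  rw [primal_mkPD, multiplier_mkPD, abs_neg]
  have hqz : ‖q - p‖ ≤ ‖zs N - z‖ := norm_primal_le (zs N - z)
  have hτz : |τ| ≤ ‖zs N - z‖ := abs_multiplier_le (zs N - z)
  calc _ ≤ (|multiplier z| * (ε * ‖q - p‖) + |τ| * ε) + ε * ‖q - p‖ := by
        refine add_le_add ((norm_sub_le _ _).trans (add_le_add ?_ ?_)) hmv
        · rw [norm_neg, norm_smul, Real.norm_eq_abs]
          gcongr
          exact h2 q hq2
        · rw [norm_smul, Real.norm_eq_abs]
          gcongr
          exact h1 q hq1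
    _ ≤ (|multiplier z| * (ε * ‖zs N - z‖) + ‖zs N - z‖ * ε) + ε * ‖zs N - z‖ := by gcongr
    _ = (ε * (|multiplier z| + 2)) * ‖zs N - z‖ := by ring
    _ = c * ‖zs N - z‖ := by rw [hε, div_mul_cancel₀ _ hC.ne']

end Asymptotics

/-! ### The limiting covariance matrix -/

section Matrices

variable {d : ℕ} {g : Alloc d → ℝ} {z : PrimalDual d}

/-- The Hessian of the Lagrangian is invertible: a kernel vector has its primal part tangent to the
constraint, hence zero by the second-order condition, and then the multiplier part vanishes because
the gradient of the constraint is nonzero. -/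
theorem IsPrimalDualSolution.isUnit_det_lagrangianHessian [Nonempty (Fin d)]
    (hz : IsPrimalDualSolution g z) (hss : SSOSC g (primal z)) :
    IsUnit (lagrangianHessian g z).det := by
  rw [isUnit_iff_ne_zero]
  intro hdet
  obtain ⟨v₀, hv₀, hAv₀⟩ := Matrix.exists_mulVec_eq_zero_iff.2 hdet
  set v : PrimalDual d := WithLp.toLp 2 v₀ with hv
  have hAv : Matrix.toEuclideanCLM (𝕜 := ℝ) (lagrangianHessian g z) v = 0 := by
    rw [hv, Matrix.toEuclideanCLM_toLp, hAv₀]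
    rfl
  rw [toEuclideanCLM_lagrangianHessian, mkPD_eq_zero] at hAv
  obtain ⟨h1, h2⟩ := hAv
  have hu : primal v = 0 := by
    by_contra hne
    have h3 := congrArg (fun w => inner ℝ (primal v) w) h1
    simp only [inner_add_right, inner_smul_right, inner_zero_right] at h3
    rw [real_inner_comm (gradient g (primal z)) (primal v), h2, mul_zero, add_zero] at h3
    exact (mul_pos hz.multiplier_pos (hss _ hne h2)).ne' h3
  have ht : multiplier v = 0 := by
    obtain ⟨k⟩ := ‹Nonempty (Fin d)›
    rw [hu, map_zero, smul_zero, zero_add, hz.gradient_eq] at h1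
    have := congrArg (fun w : Alloc d => w k) h1
    simpa [hz.multiplier_pos.ne'] using this
  have hv0 : v = 0 := by
    rw [← norm_eq_zero, ← sq_eq_zero_iff, norm_sq_eq_primal_add_multiplier, hu, ht]
    simp
  exact hv₀ (by simpa [hv] using hv0)

theorem isSymm_lagrangianHessian (hgd : ∀ᶠ m in 𝓝 (primal z), DifferentiableAt ℝ g m)
    (hgg : DifferentiableAt ℝ (gradient g) (primal z)) : (lagrangianHessian g z).IsSymm := by
  obtain ⟨J, hJ⟩ : ∃ J : Alloc d →L[ℝ] Alloc d →L[ℝ] ℝ, ∀ u v, J u v = inner ℝ u v :=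
    ⟨innerSL ℝ, fun _ _ => rfl⟩
  have hf : ∀ᶠ m in 𝓝 (primal z), HasFDerivAt g (J (gradient g m)) m := by
    filter_upwards [hgd] with m hm
    convert! hm.hasFDerivAt using 1
    ext v
    rw [hJ, inner_gradient]
  have hsym := second_derivative_symmetric_of_eventually hf
    (J.hasFDerivAt.comp (primal z) hgg.hasFDerivAt)
  have hH : (hessMatrix g (primal z)).IsSymm := by
    ext i j
    have := hsym (EuclideanSpace.single i 1) (EuclideanSpace.single j 1)
    simpa [hJ, hessMatrix, hess, EuclideanSpace.inner_single_right] using this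
  exact Matrix.IsSymm.fromBlocks (hH.smul _) rfl Matrix.isSymm_zero

variable {loss : Alloc d → EReal} {Ω : Type*} [MeasurableSpace Ω] {μ : Measure Ω}
  {X : Ω → Alloc d}

theorem measurable_lagrangianGradient (hloss : IsLossFunction loss) (hfin : ∀ x, loss x ≠ ⊤)
    (z : PrimalDual d) : Measurable fun x => lagrangianGradient (residual loss x) z := by
  have h1 := measurable_gradient_residual (loss := loss) (primal z)
  have h2 := measurable_residual hloss hfin (primal z)
  unfold lagrangianGradient mkPD
  refine (WithLp.measurable_toLp 2 _).comp (measurable_pi_iff.2 ?_)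
  rintro (k | k)
  · simp only [Sum.elim_inl, PiLp.add_apply, PiLp.smul_apply, smul_eq_mul]
    exact ((measurable_pi_iff.1 ((WithLp.measurable_ofLp 2 _).comp h1) k).const_mul _).const_add _
  · exact h2

/-- The quadratic form of the covariance matrix is the variance in the given direction. -/
theorem variance_inner_lagrangianGradient [IsFiniteMeasure μ]
    (hvar : MemLp (fun ω => lagrangianGradient (residual loss (X ω)) z) 2 μ)
    (t : PrimalDual d) :
    Var[fun ω => inner ℝ t (lagrangianGradient (residual loss (X ω)) z); μ] =
      t ⬝ᵥ (gradientCovariance μ loss X z).mulVec t := by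
  simp only [PiLp.inner_apply]
  have hL (i : Fin d ⊕ Unit) :
      MemLp (fun ω => t i * lagrangianGradient (residual loss (X ω)) z i) 2 μ :=
    (hvar.eval_piLp i).const_mul _
  have h1 := variance_fun_sum (μ := μ) hL
  simp only [RCLike.inner_apply, conj_trivial, mul_comm _ (t.ofLp _)]
  rw [h1]
  simp only [covariance_const_mul_left, covariance_const_mul_right, dotProduct, Matrix.mulVec,
    gradientCovariance, Matrix.of_apply, Finset.mul_sum]
  refine Finset.sum_congr rfl fun i _ => Finset.sum_congr rfl fun j _ => ?_
  ring

theorem posSemidef_gradientCovariance [IsFiniteMeasure μ]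
    (hvar : MemLp (fun ω => lagrangianGradient (residual loss (X ω)) z) 2 μ) :
    (gradientCovariance μ loss X z).PosSemidef := by
  refine Matrix.PosSemidef.of_dotProduct_mulVec_nonneg ?_ fun t => ?_
  · ext i j
    simp [gradientCovariance, covariance_comm]
  · have := variance_inner_lagrangianGradient hvar (WithLp.toLp 2 t)
    rw [star_trivial]
    exact this ▸ variance_nonneg _ _

theorem posSemidef_sandwichCovariance [IsFiniteMeasure μ]
    (hvar : MemLp (fun ω => lagrangianGradient (residual loss (X ω)) z) 2 μ)
    (hsym : (lagrangianHessian (expectedLoss μ loss X) z).IsSymm) :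
    (sandwichCovariance μ loss X z).PosSemidef := by
  have := (posSemidef_gradientCovariance hvar).mul_mul_conjTranspose_same
    (lagrangianHessian (expectedLoss μ loss X) z)⁻¹
  rwa [Matrix.conjTranspose_eq_transpose_of_trivial, hsym.inv.eq] at this

end Matrices

/-! ### Asymptotic normality -/

section Normality

variable {d : ℕ} {loss : Alloc d → EReal} {Ω : Type*} [MeasurableSpace Ω] {μ : Measure Ω}
  {X : Ω → Alloc d} {M : Set (Alloc d)} {D₂ : Ω → ℝ}

/-- In dimension `0` the loss would be a negative constant, and the constraint never active. -/
theorem nonempty_of_expectedLoss_eq_zero [IsProbabilityMeasure μ] (hloss : IsLossFunction loss)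
    (hfin : ∀ x, loss x ≠ ⊤) {m : Alloc d} (hm : expectedLoss μ loss X m = 0) :
    Nonempty (Fin d) := by
  by_contra hne
  rw [not_nonempty_iff] at hne
  obtain ⟨x, hx⟩ := iInf_lt_iff.1 hloss.iInf_neg
  rw [← hloss.coe_realLoss hfin] at hx
  have hconst : (fun ω => residual loss (X ω) m) = fun _ => realLoss loss x := by
    ext ω
    rw [residual_apply]
    exact congrArg _ (Subsingleton.elim _ _)
  rw [expectedLoss, hconst, integral_const, probReal_univ, one_smul] at hm
  rw [hm] at hx
  simp at hx

theorem ae_approximates_sampleLoss [IsFiniteMeasure μ] (hloss : IsLossFunction loss)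
    (hfin : ∀ x, loss x ≠ ⊤) (hX : InOrliczHeart μ loss X) (hM : IsCompact M)
    (hdiff : ∀ m₀, ∀ᵐ ω ∂μ, GradDifferentiableAt (residual loss (X ω)) m₀)
    (hlip : GradLocallyLipschitz μ loss X M) (hD₂ : Integrable D₂ μ)
    (hdom : ∀ m ∈ M, ∀ᵐ ω ∂μ, ‖hess (residual loss (X ω)) m‖ ≤ D₂ ω)
    {Xs : ℕ → Ω → Alloc d} (hindep : iIndepFun Xs μ)
    (hident : ∀ i, IdentDistrib (Xs i) X μ μ) {p : Alloc d} (hp : p ∈ interior M) :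
    ∀ᵐ ω ∂μ, Approximates (fun N => sampleLoss loss (fun i => Xs i ω) N)
      (expectedLoss μ loss X) M p := by
  filter_upwards [ae_tendstoUniformlyOn_sampleLoss hloss hfin hX hindep hident hM,
    ae_all_iff.2 fun i => hlip.ae_identDistrib (hident i),
    ae_tendsto_gradient_sampleLoss hloss hfin hX hdiff hlip hindep hident hp,
    ae_gradient_sampleLoss_expansion hloss hfin hX hdiff hlip hD₂ hdom hindep hident hp]
    with ω h1 h2 h3 h4
  have hgrad (N : ℕ) {m : Alloc d} (hm : m ∈ interior M) :=
    hasGradientAt_sampleLoss N fun i => (h2 i m hm).1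
  refine ⟨fun N => ?_, h1, fun N m hm => ⟨(hgrad N hm).differentiableAt, ?_⟩, h3, h4⟩
  · have := hloss.continuous_realLoss hfin
    unfold sampleLoss
    simp only [residual_apply]
    fun_prop
  · have h5 : (fun m => (N : ℝ)⁻¹ • ∑ i ∈ Finset.range N, gradient (residual loss (Xs i ω)) m)
        =ᶠ[𝓝 m] gradient (sampleLoss loss (fun i => Xs i ω) N) := by
      filter_upwards [isOpen_interior.mem_nhds hm] with m' hm'
      exact (hgrad N hm').gradient.symm
    refine ContinuousAt.congr ?_ h5
    exact (tendsto_finsetSum _ fun i _ => (h2 i m hm).2).const_smul _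

theorem sampleLagrangianGradient_eq {x : ℕ → Alloc d} {N : ℕ} (hN : N ≠ 0) {z : PrimalDual d}
    (h : ∀ i, DifferentiableAt ℝ (residual loss (x i)) (primal z)) :
    sampleLagrangianGradient loss x N z = lagrangianGradient (sampleLoss loss x N) z := by
  have hN' : (N : ℝ) ≠ 0 := by exact_mod_cast hN
  rw [sampleLagrangianGradient, lagrangianGradient, (hasGradientAt_sampleLoss N h).gradient]
  ext (k | k)
  · simp [lagrangianGradient, mkPD, Finset.sum_add_distrib, mul_add, hN', Finset.mul_sum,
      mul_left_comm]
  · simp [lagrangianGradient, mkPD, sampleLoss]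

theorem integral_lagrangianGradient [IsProbabilityMeasure μ] (hloss : IsLossFunction loss)
    (hfin : ∀ x, loss x ≠ ⊤) (hX : InOrliczHeart μ loss X) {z : PrimalDual d}
    (hdiff : ∀ᵐ ω ∂μ, DifferentiableAt ℝ (residual loss (X ω)) (primal z))
    (hint : Integrable (fun ω => lagrangianGradient (residual loss (X ω)) z) μ) :
    ∫ ω, lagrangianGradient (residual loss (X ω)) z ∂μ =
      lagrangianGradient (expectedLoss μ loss X) z := by
  obtain ⟨h1, h2⟩ := hasGradientAt_expectedLoss hloss hfin hX hdiff
  ext i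
  rw [eval_integral_piLp fun i => hint.eval_piLp i]
  rcases i with k | k
  · have h3 : Integrable (fun ω => multiplier z * gradient (residual loss (X ω)) (primal z) k) μ :=
      (h1.eval_piLp k).const_mul _
    simp only [lagrangianGradient, mkPD, Sum.elim_inl, PiLp.add_apply, PiLp.smul_apply, smul_eq_mul]
    rw [integral_add (integrable_const _) h3, integral_const_mul, h2.gradient,
      eval_integral_piLp fun i => h1.eval_piLp i]
    simp
  · rfl

/-- The influence function `-(∇²L)⁻¹ ∇L(X, z)` satisfies the central limit theorem with
the sandwich covariance matrix. -/
theorem tendstoInDistribution_influence [IsProbabilityMeasure μ] (hloss : IsLossFunction loss)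
    (hfin : ∀ x, loss x ≠ ⊤) (hX : InOrliczHeart μ loss X) {z : PrimalDual d}
    (hdiff : ∀ᵐ ω ∂μ, DifferentiableAt ℝ (residual loss (X ω)) (primal z))
    (hstat : lagrangianGradient (expectedLoss μ loss X) z = 0)
    (hvar : MemLp (fun ω => lagrangianGradient (residual loss (X ω)) z) 2 μ)
    (hsym : (lagrangianHessian (expectedLoss μ loss X) z).IsSymm)
    {Xs : ℕ → Ω → Alloc d} (hindep : iIndepFun Xs μ)
    (hident : ∀ i, IdentDistrib (Xs i) X μ μ) :
    TendstoInDistribution (fun (N : ℕ) ω => (√(N : ℝ))⁻¹ • ∑ i ∈ Finset.range N,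
      Matrix.toEuclideanCLM (𝕜 := ℝ) (-(lagrangianHessian (expectedLoss μ loss X) z)⁻¹)
        (lagrangianGradient (residual loss (Xs i ω)) z)) atTop id (fun _ => μ)
      (multivariateGaussian 0 (sandwichCovariance μ loss X z)) := by
  set B := (lagrangianHessian (expectedLoss μ loss X) z)⁻¹ with hB
  have hBs : B.IsSymm := hsym.inv
  set T := Matrix.toEuclideanCLM (𝕜 := ℝ) (-B) with hT
  have hint := hvar.integrable one_le_two
  refine tendstoInDistribution_inv_sqrt_smul_sum hindep hident
    (F := fun x => T (lagrangianGradient (residual loss x) z))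
    (T.continuous.measurable.comp (measurable_lagrangianGradient hloss hfin z))
    (T.comp_memLp' hvar) ?_ (posSemidef_sandwichCovariance hvar hsym) fun t => ?_
  · rw [T.integral_comp_comm hint, integral_lagrangianGradient hloss hfin hX hdiff hint, hstat,
      map_zero]
  · have hTs (v : PrimalDual d) : inner ℝ t (T v) = inner ℝ (T t) v := by
      rw [real_inner_comm v, hT, Matrix.inner_toEuclideanCLM, Matrix.inner_toEuclideanCLM,
        Matrix.dotProduct_mulVec, ← Matrix.mulVec_transpose, dotProduct_comm,
        Matrix.transpose_neg, hBs.eq]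
    simp only [hTs]
    rw [variance_inner_lagrangianGradient hvar, hT, Matrix.ofLp_toEuclideanCLM, sandwichCovariance,
      ← hB, ← Matrix.mulVec_mulVec, ← Matrix.mulVec_mulVec, Matrix.dotProduct_mulVec t.ofLp,
      ← Matrix.mulVec_transpose, hBs.eq]
    simp [Matrix.neg_mulVec, Matrix.mulVec_neg]

theorem isSAASolution_iff {lamBar : ℝ} {x : ℕ → Alloc d} {N : ℕ} {z : PrimalDual d} :
    IsSAASolution loss M lamBar x N z ↔ IsProgramMin (sampleLoss loss x N) M (primal z) ∧
      multiplier z ∈ Set.Ioc 0 lamBar ∧ sampleLagrangianGradient loss x N z = 0 :=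
  ⟨fun h => ⟨⟨h.primal_mem, h.feasible, h.isMin⟩, h.multiplier_mem, h.stationary⟩,
    fun h => ⟨h.1.1, h.2.1, h.1.2.1, h.1.2.2, h.2.2⟩⟩

end Normality

end MSRM

open MSRM

theorem propositionD2 {d : ℕ} {Ω : Type*} [MeasurableSpace Ω] (μ : Measure Ω)
    [IsProbabilityMeasure μ]
    -- the loss function and the loss vector
    (loss : MSRM.Alloc d → EReal) (hloss : MSRM.IsLossFunction loss)
    (X : Ω → MSRM.Alloc d) (hpdf : HasPDF X μ volume) (hX : MSRM.InOrliczHeart μ loss X)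
    -- the compact search region, with the exact solution in its interior
    (M : Set (MSRM.Alloc d)) (hM : IsCompact M) (lamBar : ℝ) (zstar : MSRM.PrimalDual d)
    (hz : MSRM.IsPrimalDualSolution (MSRM.expectedLoss μ loss X) zstar)
    (hzM : MSRM.primal zstar ∈ interior M) (hzlam : MSRM.multiplier zstar < lamBar)
    -- the regularity conditions for the exact problem
    (hdiff : ∀ m₀, ∀ᵐ ω ∂μ, MSRM.GradDifferentiableAt (MSRM.residual loss (X ω)) m₀)
    (hssosc : MSRM.SSOSC (MSRM.expectedLoss μ loss X) (MSRM.primal zstar))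
    -- continuity of the Hessian and integrable domination
    (hcont : ∀ m₀, ∀ᵐ ω ∂μ, MSRM.HessContinuousAt (MSRM.residual loss (X ω)) m₀)
    (hlip : MSRM.GradLocallyLipschitz μ loss X M)
    (hdom : MSRM.IntegrablyDominated μ loss X M)
    -- the variance of the gradient of the Lagrangian at the exact solution is finite
    (hvar : MemLp (fun ω => MSRM.lagrangianGradient (MSRM.residual loss (X ω)) zstar) 2 μ)
    -- independent copies of `X`, and a measurable choice of solutions of the SAA problems
    (Xs : ℕ → Ω → MSRM.Alloc d) (hindep : iIndepFun Xs μ)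
    (hident : ∀ i, IdentDistrib (Xs i) X μ μ)
    (zSAA : ℕ → Ω → MSRM.PrimalDual d) (hmeas : ∀ N, AEMeasurable (zSAA N) μ)
    (hSAA : ∀ N, ∀ᵐ ω ∂μ,
      (∃ z, MSRM.IsSAASolution loss M lamBar (fun i => Xs i ω) N z) →
        MSRM.IsSAASolution loss M lamBar (fun i => Xs i ω) N (zSAA N ω)) :
    IsUnit (MSRM.lagrangianHessian (MSRM.expectedLoss μ loss X) zstar).det ∧
      (MSRM.sandwichCovariance μ loss X zstar).PosSemidef ∧
      TendstoInDistribution (fun (N : ℕ) ω => √(N : ℝ) • (zSAA N ω - zstar)) atTop id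
        (fun _ => μ) (multivariateGaussian 0 (MSRM.sandwichCovariance μ loss X zstar)) := by
  have hfin : ∀ x, loss x ≠ ⊤ := hloss.ne_top hpdf hX
  have hne : Nonempty (Fin d) := nonempty_of_expectedLoss_eq_zero hloss hfin hz.apply_eq_zero
  obtain ⟨D₀, D₁, D₂, -, -, hD₂, hdom⟩ := hdom
  replace hdom : ∀ m ∈ M, ∀ᵐ ω ∂μ, ‖hess (residual loss (X ω)) m‖ ≤ D₂ ω :=
    fun m hm => (hdom m hm).mono fun ω h => h.2.2
  have hdiff₁ (m : Alloc d) : ∀ᵐ ω ∂μ, DifferentiableAt ℝ (residual loss (X ω)) m :=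
    (hdiff m).mono fun ω h => h.1.self_of_nhds
  set g := expectedLoss μ loss X with hg
  have hgd (m : Alloc d) : DifferentiableAt ℝ g m :=
    (hasGradientAt_expectedLoss hloss hfin hX (hdiff₁ m)).2.differentiableAt
  have hgg : DifferentiableAt ℝ (gradient g) (primal zstar) :=
    (hasFDerivAt_gradient_expectedLoss hloss hfin hX hdiff hlip hD₂ hdom hzM).differentiableAt
  have hgc : ContinuousOn g M := fun m _ => (hgd m).continuousAt.continuousWithinAt
  have huniq : ∀ m, g m ≤ 0 → ∑ k, m k ≤ ∑ k, primal zstar k → m = primal zstar :=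
    fun m h1 h2 => hz.eq_of_sum_le (convexOn_expectedLoss hloss hfin hX)
      (Eventually.of_forall hgd) hgg hssosc h1 h2
  have hunit := hz.isUnit_det_lagrangianHessian hssosc
  have hsym : (lagrangianHessian g zstar).IsSymm :=
    isSymm_lagrangianHessian (Eventually.of_forall hgd) hgg
  refine ⟨hunit, posSemidef_sandwichCovariance hvar hsym, ?_⟩
  refine tendstoInDistribution_of_isLittleO (tendstoInDistribution_influence hloss hfin hX
    (hdiff₁ _) hz.stationary hvar hsym hindep hident)
    (fun N => ((hmeas N).sub_const zstar).fun_const_smul _) ?_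
  filter_upwards [ae_approximates_sampleLoss hloss hfin hX hM hdiff hlip hD₂ hdom hindep hident hzM,
    ae_all_iff.2 hSAA, ae_all_iff.2 fun i => hlip.ae_identDistrib (hident i)] with ω happ hsol hsm
  set x : ℕ → Alloc d := fun i => Xs i ω with hx
  have hgradeq {N : ℕ} (hN : N ≠ 0) {z : PrimalDual d} (hzN : primal z ∈ interior M) :
      sampleLagrangianGradient loss x N z = lagrangianGradient (sampleLoss loss x N) z :=
    sampleLagrangianGradient_eq hN fun i => (hsm i _ hzN).1
  have hev : ∀ᶠ N in atTop, IsSAASolution loss M lamBar x N (zSAA N ω) := by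
    filter_upwards [happ.eventually_exists_solution hM hz hzM (hgd _) hgc huniq hzlam,
      eventually_ne_atTop 0] with N ⟨z', h1, h2, h3, h4⟩ hN
    exact hsol N ⟨z', isSAASolution_iff.2 ⟨h1, h3, by rw [hgradeq hN h2, h4]⟩⟩
  have hstat : ∀ᶠ N in atTop, primal (zSAA N ω) ∈ interior M →
      lagrangianGradient (sampleLoss loss x N) (zSAA N ω) = 0 := by
    filter_upwards [hev, eventually_ne_atTop 0] with N h1 hN h2
    rw [← hgradeq hN h2, h1.stationary]
  have hlim : Tendsto (fun N => zSAA N ω) atTop (𝓝 zstar) :=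
    happ.tendsto_solution hM hz hzM (hgd _) hgc huniq
      (hev.mono fun N h => (isSAASolution_iff.1 h).1) hstat
  set A := lagrangianHessian g zstar with hA
  have hBA (v : PrimalDual d) :
      Matrix.toEuclideanCLM (𝕜 := ℝ) A⁻¹ (Matrix.toEuclideanCLM (𝕜 := ℝ) A v) = v := by
    rw [← mul_apply_eq_comp, ← map_mul, Matrix.nonsing_inv_mul A hunit, map_one]
    rfl
  -- Solve the expansion of the first-order conditions for `zSAA N ω - zstar`.
  have hrel : (fun N : ℕ => √(N : ℝ) • (zSAA N ω - zstar) -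
      (√(N : ℝ))⁻¹ • ∑ i ∈ Finset.range N, Matrix.toEuclideanCLM (𝕜 := ℝ) (-A⁻¹)
        (lagrangianGradient (residual loss (Xs i ω)) zstar)) =o[atTop]
      fun N : ℕ => √(N : ℝ) • (zSAA N ω - zstar) := by
    have h1 := ((Matrix.toEuclideanCLM (𝕜 := ℝ) A⁻¹).isBigO_comp _ atTop).trans_isLittleO
      (happ.isLittleO_lagrangianGradient hzM hlim hstat)
    refine ((Asymptotics.isBigO_refl (fun N : ℕ => √(N : ℝ)) atTop).smul_isLittleO h1).congr' ?_
      EventuallyEq.rfl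
    filter_upwards [eventually_ne_atTop 0] with N hN
    have hsqrt : (√(N : ℝ))⁻¹ = √(N : ℝ) * (N : ℝ)⁻¹ := by
      rw [← div_eq_mul_inv, Real.sqrt_div_self']
      simp
    rw [map_add, hBA, ← hgradeq hN hzM, sampleLagrangianGradient, hsqrt, map_neg]
    simp only [neg_apply, Finset.sum_neg_distrib, map_smul, map_sum, smul_add, smul_neg, mul_smul]
    abel
  have hbig := hrel.right_isBigO_sub
  simp only [sub_sub_cancel] at hbig
  exact hrel.trans_isBigO hbig
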